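/- Let $(E,d)$ be a compact metric space and let $\{P_r(x,\mathrm dy)\}_{r\ge 0}$ be a time-homogeneous Markov transition function on $E$ such that $S(r)f(x)=\int f(y)\,P_r(x,\mathrm dy)$ defines a strongly continuous semigroup on $(C(E),\|\cdot\|_\infty)$, with infinitesimal generator $(A,\mathcal D(A))$. Put $V(r)f=\log S(r)e^f$. Let $D\subseteq\mathcal D(A)$ be a linear subspace that is a core for $A$ and is dense in $C(E)$, such that $fg\in D$ for $f,g\in D$ and $\phi\circ f\in D$ for $f\in D$ and $\phi$ smooth on the range of $f$. Let $\tau_D$ be a topology on $D$ such that (a) $(D,\tau_D)$ is a separable barrelled locally convex Hausdorff space; (b) $\tau_D$ is finer than the sup-norm topology; (c) $f\mapsto e^f-1$ and $(f,g)\mapsto fg$ are continuous for $\tau_D$; (d) $S(r)D\subseteq D$ and $V(r)D\subseteq D$ for all $r\ge0$, and both semigroups restricted to $D$ are strongly continuous for $\tau_D$ (each operator is continuous $(D,\tau_D)\to(D,\tau_D)$, and all orbits $r\mapsto S(r)f$, $r\mapsto V(r)f$ are continuous); (e) $A:(D,\tau_D)\to(C(E),\|\cdot\|_\infty)$ is continuous;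 (f) with $Hf=e^{-f}Ae^f$, there is a barrel $\mathcal N\subseteq D$ with $\sup_{f\in\mathcal N}\|Hf\|\le1$ and $\sup_{f\in c\mathcal N}\|Hf\|<\infty$ for every $c>0$. Let $D'$ be the continuous dual of $(D,\tau_D)$ and, for a probability measure $\mu$ on $E$ and $u\in D'$, let $$\mathcal L(\mu,u)=\sup_{f\in D}\{\langle f,u\rangle-\langle Hf,\mu\rangle\}.$$ A weakly continuous curve $\nu:[0,\infty)\to\mathcal P(E)$ is called absolutely continuous if there is a weak* measurable curve $u:[0,\infty)\to D'$ with $\int_0^r|\langle f,u(s)\rangle|\,\mathrm ds<\infty$ and $\langle f,\nu(r)\rangle-\langle f,\nu(0)\rangle=\int_0^r\langle f,u(s)\rangle\,\mathrm ds$ for all $f\in D$, $r\ge0$; any such $u$ is denoted $\dot\nu$. The relative entropy is $H(\mu\,|\,\nu)=\int\log\frac{\mathrm d\mu}{\mathrm d\nu}\,\mathrm d\mu$ if $\mu\ll\nu$, and $+\infty$ otherwise. Let $\mathbb P$ be the law, on the space $D_E(\mathbb R^+)$ of càdlàg paths, of a Markov process $X$ with this transition function and initial law $\mathbb P_0$.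 Let $t\ge0$, $h\in D$, and let $\rho_0:E\to[0,\infty)$ be measurable such that $$\frac{\mathrm d\mathbb Q}{\mathrm d\mathbb P}(X)=\rho_0(X(0))\,e^{h(X(t))}$$ defines a probability measure $\mathbb Q$ on $D_E(\mathbb R^+)$. Let $\gamma(s)$ be the law of $X(s)$ under $\mathbb Q$, let $\mathbb Q_0=\gamma(0)$, and let $\mathbb P^{\gamma(0)}$ be the Markov measure on $D_E(\mathbb R^+)$ with the same transition function and initial law $\gamma(0)$. Then $\mathbb P^{\gamma(0)}$ exists, the curve $\gamma$ is absolutely continuous, and, for every choice of $\dot\gamma$, $$H(\mathbb Q\,|\,\mathbb P)=H(\mathbb Q_0\,|\,\mathbb P_0)+H(\mathbb Q\,|\,\mathbb P^{\gamma(0)})=H(\mathbb Q_0\,|\,\mathbb P_0)+\int_0^t\mathcal L(\gamma(s),\dot\gamma(s))\,\mathrm ds,$$ as an identity in $[0,\infty]$. -/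

import Mathlib

open MeasureTheory ProbabilityTheory Filter Topology
open scoped NNReal ENNReal Pointwise

noncomputable section

namespace DoobEntropy

/-! ### Path space -/

/-- `D_E(ℝ⁺)`: right-continuous paths `[0,∞) → E` with left limits. -/
def CadlagPath (E : Type*) [TopologicalSpace E] : Type _ :=
  {x : ℝ≥0 → E // ∀ t, ContinuousWithinAt x (Set.Ici t) t ∧ ∃ l, Tendsto x (𝓝[<] t) (𝓝 l)}

namespace CadlagPath

variable {E : Type*} [TopologicalSpace E]

/-- The coordinate `X(t)`. -/
def eval (t : ℝ≥0) (X : CadlagPath E) : E := X.1 t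

variable [MeasurableSpace E]

/-- The σ-algebra generated by the coordinates `X(t)`, `t ≥ 0`; for separable metric `E` it is
the Borel σ-algebra of the Skorokhod topology. -/
instance : MeasurableSpace (CadlagPath E) :=
  Subtype.instMeasurableSpace

theorem measurable_eval (t : ℝ≥0) : Measurable (eval t : CadlagPath E → E) :=
  (measurable_pi_apply t).comp measurable_subtype_coe

/-- The law of `X(t)` under a probability measure `Q` on path space. -/
def law (Q : Measure (CadlagPath E)) [IsProbabilityMeasure Q] (t : ℝ≥0) : ProbabilityMeasure E :=
  ⟨Q.map (eval t), Measure.isProbabilityMeasure_map (measurable_eval t).aemeasurable⟩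

/-- The natural filtration `σ(X(s), s ≤ t)`. -/
def pathFiltration (E : Type*) [MetricSpace E] [CompactSpace E] [MeasurableSpace E]
    [BorelSpace E] : Filtration ℝ≥0 (inferInstance : MeasurableSpace (CadlagPath E)) :=
  Filtration.natural (fun t => eval t) fun t => (measurable_eval t).stronglyMeasurable

end CadlagPath

/-! ### Feller transition functions, semigroup and generator -/

/-- A time-homogeneous Markov transition function on `E` whose operators `S(t)` map `C(E)` to
`C(E)` and are strongly continuous for the sup norm. -/
structure FellerTransition (E : Type*) [MetricSpace E] [CompactSpace E] [MeasurableSpace E]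
    [BorelSpace E] where
  kernel : ℝ≥0 → Kernel E E
  isMarkov : ∀ t, IsMarkovKernel (kernel t)
  kernel_zero : kernel 0 = Kernel.id
  kernel_add : ∀ s t, kernel (s + t) = kernel t ∘ₖ kernel s
  feller : ∀ t (f : C(E, ℝ)), Continuous fun x => ∫ y, f y ∂(kernel t x)
  strongly_continuous : ∀ f : C(E, ℝ),
    Continuous fun t => (⟨fun x => ∫ y, f y ∂(kernel t x), feller t f⟩ : C(E, ℝ))

/-- `e^f` as an element of `C(E)`. -/
def expC {E : Type*} [TopologicalSpace E] (f : C(E, ℝ)) : C(E, ℝ) :=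
  ⟨fun x => Real.exp (f x), Real.continuous_exp.comp f.continuous⟩

namespace FellerTransition

variable {E : Type*} [MetricSpace E] [CompactSpace E] [MeasurableSpace E] [BorelSpace E]
  (T : FellerTransition E)

/-- The semigroup `S(t) f(x) = 𝔼[f(X(t)) | X(0) = x]`. -/
def S (t : ℝ≥0) (f : C(E, ℝ)) : C(E, ℝ) :=
  ⟨fun x => ∫ y, f y ∂(T.kernel t x), T.feller t f⟩

theorem S_expC_pos (t : ℝ≥0) (f : C(E, ℝ)) (x : E) : 0 < T.S t (expC f) x := by
  have := T.isMarkov t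
  have hi : Integrable (fun y => Real.exp (f y)) (T.kernel t x) :=
    (expC f).continuous.integrable_of_hasCompactSupport
      (HasCompactSupport.of_compactSpace _)
  exact integral_exp_pos hi

/-- The non-linear semigroup `V(t) f = log S(t) e^f`. -/
def V (t : ℝ≥0) (f : C(E, ℝ)) : C(E, ℝ) :=
  ⟨fun x => Real.log (T.S t (expC f) x),
    (T.S t (expC f)).continuous.log fun x => (T.S_expC_pos t f x).ne'⟩

/-- The difference quotient `(S(t) f - f) / t`. -/
def quotient (f : C(E, ℝ)) (t : ℝ≥0) : C(E, ℝ) := (t : ℝ)⁻¹ • (T.S t f - f)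

/-- The domain `𝒟(A)` of the infinitesimal generator. -/
def genDomain : Set C(E, ℝ) := {f | ∃ g, Tendsto (T.quotient f) (𝓝[>] 0) (𝓝 g)}

/-- The infinitesimal generator `A`, meaningful on `genDomain`. -/
def gen (f : C(E, ℝ)) : C(E, ℝ) := limUnder (𝓝[>] 0) (T.quotient f)

/-- The Hamiltonian `H f = e^{-f} A e^f`. -/
def hamiltonian (f : C(E, ℝ)) : C(E, ℝ) := expC (-f) * T.gen (expC f)

/-- `P` is the Markov measure on path space with initial law `μ` and transition function `T`. -/
structure IsMarkovMeasure (μ : Measure E) (P : Measure (CadlagPath E)) : Prop where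
  isProb : IsProbabilityMeasure P
  initial : P.map (CadlagPath.eval 0) = μ
  markov : ∀ (s r : ℝ≥0) (f : C(E, ℝ)),
    P[fun X => f (X.eval (s + r)) | CadlagPath.pathFiltration E s]
      =ᵐ[P] fun X => T.S r f (X.eval s)

end FellerTransition

/-! ### The core `D` with its own topology -/

/-- The vector space `D ⊆ C(E)` as a type of its own, without the sup-norm topology, so that it
can carry the topology `τ_D`. -/
def CoreSpace {E : Type*} [TopologicalSpace E] (D : Submodule ℝ C(E, ℝ)) : Type _ := D

namespace CoreSpace

variable {E : Type*} [TopologicalSpace E] (D : Submodule ℝ C(E, ℝ))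

instance : AddCommGroup (CoreSpace D) := inferInstanceAs (AddCommGroup D)

instance : Module ℝ (CoreSpace D) := inferInstanceAs (Module ℝ D)

/-- The inclusion `D → C(E)`. -/
def incl : CoreSpace D →ₗ[ℝ] C(E, ℝ) := D.subtype

/-- The (possibly non-linear) family of operators `W(t)` maps `D` into `D`, and its restriction to
`D` is strongly continuous for `τ_D`: every `W(t) : D → D` and every orbit `t ↦ W(t) f` is
continuous. -/
def RestrictsStronglyContinuously [TopologicalSpace (CoreSpace D)]
    (W : ℝ≥0 → C(E, ℝ) → C(E, ℝ)) : Prop :=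
  ∃ w : ℝ≥0 → CoreSpace D → CoreSpace D,
    (∀ t f, incl D (w t f) = W t (incl D f)) ∧
    (∀ t, Continuous (w t)) ∧ ∀ f, Continuous fun t => w t f

end CoreSpace

section

variable {E : Type*} [MetricSpace E] [CompactSpace E] [MeasurableSpace E] [BorelSpace E]

open CoreSpace

/-- `D` is a core of the generator, dense in `C(E)`, an algebra, and stable under composition with
smooth functions. -/
structure IsSmoothCore (T : FellerTransition E) (D : Submodule ℝ C(E, ℝ)) : Prop where
  subset_domain : ∀ f ∈ D, f ∈ T.genDomain
  core : ∀ f ∈ T.genDomain, ∃ g : ℕ → C(E, ℝ), (∀ n, g n ∈ D) ∧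
    Tendsto g atTop (𝓝 f) ∧ Tendsto (fun n => T.gen (g n)) atTop (𝓝 (T.gen f))
  dense : Dense (D : Set C(E, ℝ))
  mul_mem : ∀ f ∈ D, ∀ g ∈ D, f * g ∈ D
  comp_mem : ∀ f ∈ D, ∀ (φ : ℝ → ℝ) (hφ : ContDiff ℝ (⊤ : ℕ∞) φ),
    (⟨fun x => φ (f x), hφ.continuous.comp f.continuous⟩ : C(E, ℝ)) ∈ D

/-- The conditions on the core `D` with its topology `τ_D`. -/
structure IsTopologicalCore (T : FellerTransition E) (D : Submodule ℝ C(E, ℝ))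
    [TopologicalSpace (CoreSpace D)] : Prop extends IsSmoothCore T D where
  /-- `(D, τ_D)` is a separable barrelled locally convex Hausdorff space. -/
  topologicalAddGroup : IsTopologicalAddGroup (CoreSpace D)
  continuousSMul : ContinuousSMul ℝ (CoreSpace D)
  locallyConvex : LocallyConvexSpace ℝ (CoreSpace D)
  hausdorff : T2Space (CoreSpace D)
  separable : TopologicalSpace.SeparableSpace (CoreSpace D)
  barrelled : BarrelledSpace ℝ (CoreSpace D)
  /-- `τ_D` is finer than the sup-norm topology. -/
  finer : Continuous (incl D)
  /-- `f ↦ e^f - 1` and multiplication are continuous on `D`. -/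
  exp_continuous : ∃ e : CoreSpace D → CoreSpace D,
    (∀ f, incl D (e f) = expC (incl D f) - 1) ∧ Continuous e
  mul_continuous : ∃ m : CoreSpace D × CoreSpace D → CoreSpace D,
    (∀ f g, incl D (m (f, g)) = incl D f * incl D g) ∧ Continuous m
  /-- `S(t)` and `V(t)` restrict to strongly continuous semigroups on `(D, τ_D)`. -/
  S_restricts : RestrictsStronglyContinuously D T.S
  V_restricts : RestrictsStronglyContinuously D T.V
  /-- `A : (D, τ_D) → (C(E), ‖·‖)` is continuous. -/
  gen_continuous : Continuous fun f : CoreSpace D => T.gen (incl D f)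
  /-- There is a barrel on which `‖H f‖ ≤ 1` and on all multiples of which `‖H f‖` is bounded. -/
  barrel : ∃ N : Set (CoreSpace D),
    Convex ℝ N ∧ Balanced ℝ N ∧ Absorbent ℝ N ∧ IsClosed N ∧
    (∀ f ∈ N, ‖T.hamiltonian (incl D f)‖ ≤ 1) ∧
    ∀ c : ℝ, 0 < c → ∃ C : ℝ, ∀ f ∈ c • N, ‖T.hamiltonian (incl D f)‖ ≤ C

/-! ### Absolutely continuous curves and the Lagrangian -/

/-- `u` is a derivative `ν̇` of the curve `ν` of probability measures: `u` is a weak* (Lebesgue)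
measurable curve in `D'`, `s ↦ ⟨f, u(s)⟩` is locally integrable for every `f ∈ D`, and
`ν(t) - ν(0) = ∫₀ᵗ u(s) ds` as a Gelfand integral. -/
structure IsDerivativeOf {D : Submodule ℝ C(E, ℝ)} [TopologicalSpace (CoreSpace D)]
    (u : ℝ≥0 → CoreSpace D →L[ℝ] ℝ) (ν : ℝ≥0 → ProbabilityMeasure E) : Prop where
  measurable : ∀ f : CoreSpace D,
    AEMeasurable (fun s : ℝ => u s.toNNReal f) (volume.restrict (Set.Ici 0))
  integrable : ∀ (f : CoreSpace D) (t : ℝ≥0),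
    ∫⁻ s in Set.Icc (0 : ℝ) t, ‖u s.toNNReal f‖ₑ < ∞
  integral_eq : ∀ (f : CoreSpace D) (t : ℝ≥0),
    (∫ x, incl D f x ∂(ν t : Measure E)) - (∫ x, incl D f x ∂(ν 0 : Measure E))
      = ∫ s in Set.Icc (0 : ℝ) t, u s.toNNReal f

/-- The class `D-𝒜𝒞` of absolutely continuous curves in `𝒫(E)`. -/
def IsAbsolutelyContinuousCurve (D : Submodule ℝ C(E, ℝ)) [TopologicalSpace (CoreSpace D)]
    (ν : ℝ≥0 → ProbabilityMeasure E) : Prop :=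
  Continuous ν ∧ ∃ u : ℝ≥0 → CoreSpace D →L[ℝ] ℝ, IsDerivativeOf u ν

/-- The Lagrangian `ℒ(μ, u) = sup_{f ∈ D} (⟨f, u⟩ - ⟨H f, μ⟩)`. -/
def lagrangian (T : FellerTransition E) {D : Submodule ℝ C(E, ℝ)} [TopologicalSpace (CoreSpace D)]
    (μ : ProbabilityMeasure E) (u : CoreSpace D →L[ℝ] ℝ) : EReal :=
  ⨆ f : CoreSpace D, ((u f - (∫ x, T.hamiltonian (incl D f) x ∂(μ : Measure E)) : ℝ) : EReal)

/-- The cost `∫₀ᵗ ℒ(ν(s), u(s)) ds ∈ [0, ∞]`. On the smooth core the supremum defining `ℒ` is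
nonnegative (take `f = 0`), so `EReal.toENNReal` is only a change of type. -/
def lagrangianCost (T : FellerTransition E) {D : Submodule ℝ C(E, ℝ)}
    [TopologicalSpace (CoreSpace D)] (ν : ℝ≥0 → ProbabilityMeasure E)
    (u : ℝ≥0 → CoreSpace D →L[ℝ] ℝ) (t : ℝ≥0) : ℝ≥0∞ :=
  ∫⁻ s in Set.Icc (0 : ℝ) t, (lagrangian T (ν s.toNNReal) (u s.toNNReal)).toENNReal

end

end DoobEntropy

end

/-! `Q` is a Doob transform. Put `k_s = S(t-s)e^h` and `g_s = log k_s = V(t-s)h`. The path density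
factorises as `ρ₀(X 0) e^{h(X t)} = (ρ₀ S(t)e^h)(X 0) · e^{h(X t) - V(t)h(X 0)}`. The first factor
is the density of `Q₀` with respect to `P₀`; reweighting `P` by it yields a Markov measure started
from `Q₀`, and such a measure is unique. Taking logarithms splits the entropy into that of the
initial laws and the expectation under `Q` of the bounded variable `h(X t) - V(t)h(X 0)`.

It remains to write this expectation as an action. With `m = ρ₀ P₀`, the marginals for `s ≤ t`
satisfy `⟨F, γ(s)⟩ = ⟨S(s)(F k_s), m⟩`. Differentiation gives the velocity `f ↦ ⟨S(s)(A(f k_s) - f A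
k_s), m⟩`. Against this velocity, the positive maximum principle shows that the supremum defining
the Lagrangian is attained at `f = g_s` (`gen_mul_sub_le`, `lagrangian_eq`). Its value is the right
derivative of `s ↦ ⟨S(s)(g_s k_s), m⟩ = ⟨g_s, γ(s)⟩`, because `g k = k log k` has derivative `(1 +
g) k'`. The integral therefore telescopes to `⟨h, γ(t)⟩ - ⟨V(t)h, γ(0)⟩` (`lagrangianCost_eq`). The
choice of derivative is immaterial because separability of `D` makes derivatives unique almost
everywhere. -/

set_option linter.unusedSectionVars false

/-! ### Feller semigroups, their generators, and right derivatives of moving orbits. -/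

noncomputable section

namespace DoobEntropy

namespace FellerTransition

variable {E : Type*} [MetricSpace E] [CompactSpace E] [MeasurableSpace E] [BorelSpace E]
  (T : FellerTransition E)

theorem integrable_continuousMap {μ : Measure E} [IsFiniteMeasure μ] (f : C(E, ℝ)) :
    Integrable (fun x => f x) μ :=
  f.continuous.integrable_of_hasCompactSupport (HasCompactSupport.of_compactSpace _)

theorem S_apply (t : ℝ≥0) (f : C(E, ℝ)) (x : E) : T.S t f x = ∫ y, f y ∂(T.kernel t x) := rfl

theorem S_add (t : ℝ≥0) (f g : C(E, ℝ)) : T.S t (f + g) = T.S t f + T.S t g := by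
  have := T.isMarkov t
  ext x
  exact integral_add (integrable_continuousMap f) (integrable_continuousMap g)

theorem S_smul (t : ℝ≥0) (c : ℝ) (f : C(E, ℝ)) : T.S t (c • f) = c • T.S t f := by
  ext x
  exact integral_const_mul c _

theorem S_sub (t : ℝ≥0) (f g : C(E, ℝ)) : T.S t (f - g) = T.S t f - T.S t g := by
  have := T.isMarkov t
  ext x
  exact integral_sub (integrable_continuousMap f) (integrable_continuousMap g)

theorem S_one (t : ℝ≥0) : T.S t 1 = 1 := by
  have := T.isMarkov t
  ext x
  simp [S_apply]

theorem S_nonneg (t : ℝ≥0) {f : C(E, ℝ)} (hf : ∀ x, 0 ≤ f x) (x : E) : 0 ≤ T.S t f x :=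
  integral_nonneg hf

theorem norm_S_le (t : ℝ≥0) (f : C(E, ℝ)) : ‖T.S t f‖ ≤ ‖f‖ := by
  have := T.isMarkov t
  refine (ContinuousMap.norm_le _ (norm_nonneg _)).2 fun x => ?_
  refine (norm_integral_le_of_norm_le_const
    (Eventually.of_forall fun y => f.norm_coe_le_norm y)).trans ?_
  simp

theorem S_zero_apply (f : C(E, ℝ)) : T.S 0 f = f := by
  ext x
  rw [S_apply, T.kernel_zero, Kernel.id_apply, integral_dirac]

theorem S_comp (s t : ℝ≥0) (f : C(E, ℝ)) : T.S (s + t) f = T.S s (T.S t f) := by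
  have := T.isMarkov s
  have := T.isMarkov t
  ext x
  rw [S_apply, T.kernel_add, Kernel.integral_comp (integrable_continuousMap f)]
  rfl

/-- Contractivity upgrades strong continuity to joint continuity, which is what lets the time and
the argument move together in the product rules below. -/
theorem continuous_S : Continuous fun p : ℝ≥0 × C(E, ℝ) => T.S p.1 p.2 := by
  rw [continuous_iff_continuousAt]
  rintro ⟨s, f⟩
  have h1 : Tendsto (fun p : ℝ≥0 × C(E, ℝ) => T.S p.1 f) (𝓝 (s, f)) (𝓝 (T.S s f)) :=
    ((T.strongly_continuous f).comp continuous_fst).tendsto (s, f)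
  have h2 : Tendsto (fun p : ℝ≥0 × C(E, ℝ) => T.S p.1 (p.2 - f)) (𝓝 (s, f)) (𝓝 0) := by
    refine squeeze_zero_norm (fun p => T.norm_S_le p.1 (p.2 - f)) ?_
    have : Continuous fun p : ℝ≥0 × C(E, ℝ) => ‖p.2 - f‖ := by fun_prop
    simpa using this.tendsto (s, f)
  have h3 := h1.add h2
  rw [add_zero] at h3
  refine h3.congr fun p => ?_
  rw [← S_add, add_sub_cancel]

theorem continuous_S_comp {X : Type*} [TopologicalSpace X] {a : X → ℝ≥0} {u : X → C(E, ℝ)}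
    (ha : Continuous a) (hu : Continuous u) : Continuous fun x => T.S (a x) (u x) :=
  T.continuous_S.comp (ha.prodMk hu)

variable {T}

theorem tendsto_quotient {f : C(E, ℝ)} (hf : f ∈ T.genDomain) :
    Tendsto (T.quotient f) (𝓝[>] 0) (𝓝 (T.gen f)) :=
  tendsto_nhds_limUnder hf

theorem gen_eq {f g : C(E, ℝ)} (h : Tendsto (T.quotient f) (𝓝[>] 0) (𝓝 g)) : T.gen f = g :=
  tendsto_nhds_unique (tendsto_quotient ⟨g, h⟩) h

theorem tendsto_quotient_add {f g f' g' : C(E, ℝ)}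
    (hf : Tendsto (T.quotient f) (𝓝[>] 0) (𝓝 f')) (hg : Tendsto (T.quotient g) (𝓝[>] 0) (𝓝 g')) :
    Tendsto (T.quotient (f + g)) (𝓝[>] 0) (𝓝 (f' + g')) := by
  refine (hf.add hg).congr fun t => ?_
  simp only [quotient, S_add]
  module

theorem tendsto_quotient_smul {f f' : C(E, ℝ)} (c : ℝ)
    (hf : Tendsto (T.quotient f) (𝓝[>] 0) (𝓝 f')) :
    Tendsto (T.quotient (c • f)) (𝓝[>] 0) (𝓝 (c • f')) := by
  refine (hf.const_smul c).congr fun t => ?_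
  simp only [quotient, S_smul]
  module

theorem gen_add {f g : C(E, ℝ)} (hf : f ∈ T.genDomain) (hg : g ∈ T.genDomain) :
    T.gen (f + g) = T.gen f + T.gen g :=
  gen_eq (tendsto_quotient_add (tendsto_quotient hf) (tendsto_quotient hg))

theorem gen_smul (c : ℝ) {f : C(E, ℝ)} (hf : f ∈ T.genDomain) :
    T.gen (c • f) = c • T.gen f :=
  gen_eq (tendsto_quotient_smul c (tendsto_quotient hf))

theorem gen_one : T.gen 1 = 0 := by
  refine gen_eq (tendsto_const_nhds.congr fun t => ?_)
  simp [quotient, S_one]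

theorem gen_S (r : ℝ≥0) {f : C(E, ℝ)} (hf : f ∈ T.genDomain) :
    T.gen (T.S r f) = T.S r (T.gen f) := by
  refine gen_eq ?_
  have h : Continuous (T.S r) := T.continuous_S_comp continuous_const continuous_id
  refine ((h.tendsto _).comp (tendsto_quotient hf)).congr fun t => ?_
  simp only [Function.comp, quotient, S_smul, S_sub, ← S_comp, add_comm]

/-- The positive maximum principle. -/
theorem gen_nonneg_of_isMin {f : C(E, ℝ)} (hf : f ∈ T.genDomain) (hpos : ∀ y, 0 ≤ f y) {x : E}
    (hx : f x = 0) : 0 ≤ T.gen f x := by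
  have h := ((continuous_eval_const (F := C(E, ℝ)) x).tendsto _).comp (tendsto_quotient hf)
  refine ge_of_tendsto' h fun t => ?_
  simp only [Function.comp, quotient, ContinuousMap.smul_apply, ContinuousMap.sub_apply, hx,
    sub_zero, smul_eq_mul]
  exact mul_nonneg (by positivity) (T.S_nonneg t hpos x)

theorem tendsto_toNNReal_sub (s : ℝ) :
    Tendsto (fun r : ℝ => (r - s).toNNReal) (𝓝[>] s) (𝓝[>] 0) := by
  refine tendsto_nhdsWithin_iff.2 ⟨?_, ?_⟩
  · have : Continuous fun r : ℝ => (r - s).toNNReal := by fun_prop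
    simpa using (this.tendsto s).mono_left nhdsWithin_le_nhds
  · filter_upwards [self_mem_nhdsWithin] with r hr
    simpa using hr

/-- Right derivative of `r ↦ S(r) u(r)` for a curve `u` differentiable from the right at `s`. -/
theorem hasDerivWithinAt_S {u : ℝ → C(E, ℝ)} {u' : C(E, ℝ)} {s : ℝ} (hs : 0 ≤ s)
    (hu : HasDerivWithinAt u u' (Set.Ioi s) s) (hus : u s ∈ T.genDomain) :
    HasDerivWithinAt (fun r : ℝ => T.S r.toNNReal (u r))
      (T.S s.toNNReal (T.gen (u s) + u')) (Set.Ioi s) s := by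
  rw [hasDerivWithinAt_iff_tendsto_slope' (by simp)] at hu ⊢
  -- Product rule: `S(r)u(r) - S(s)u(s) = S(r)(u(r) - u(s)) + S(s)(S(r-s) - 1)u(s)`. The generator
  -- is a one-sided limit, hence only right derivatives.
  have h1 : Tendsto (fun r : ℝ => T.S r.toNNReal (slope u s r)) (𝓝[>] s)
      (𝓝 (T.S s.toNNReal u')) := by
    have hr : Tendsto (fun r : ℝ => r.toNNReal) (𝓝[>] s) (𝓝 s.toNNReal) :=
      (continuous_real_toNNReal.tendsto s).mono_left nhdsWithin_le_nhds
    exact (T.continuous_S.tendsto (s.toNNReal, u')).comp (hr.prodMk_nhds hu)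
  have h2 : Tendsto (fun r : ℝ => T.S s.toNNReal (T.quotient (u s) (r - s).toNNReal)) (𝓝[>] s)
      (𝓝 (T.S s.toNNReal (T.gen (u s)))) := by
    have h : Continuous (T.S s.toNNReal) := T.continuous_S_comp continuous_const continuous_id
    exact (h.tendsto _).comp ((tendsto_quotient hus).comp (tendsto_toNNReal_sub s))
  rw [S_add, add_comm]
  refine (h1.add h2).congr' ?_
  filter_upwards [self_mem_nhdsWithin] with r hr
  have hrs : 0 ≤ r - s := sub_nonneg.2 (le_of_lt hr)
  have e : r.toNNReal = s.toNNReal + (r - s).toNNReal := by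
    rw [← Real.toNNReal_add hs hrs, add_sub_cancel]
  simp only [slope, vsub_eq_sub, quotient, S_smul, S_sub, Real.coe_toNNReal _ hrs, ← S_comp, ← e]
  module

/-- Right derivative of the time-reversed orbit `r ↦ S(t - r) f`. -/
theorem hasDerivWithinAt_S_sub {f : C(E, ℝ)} (hf : f ∈ T.genDomain) {s t : ℝ} (hst : s < t) :
    HasDerivWithinAt (fun r : ℝ => T.S (t - r).toNNReal f)
      (-T.gen (T.S (t - s).toNNReal f)) (Set.Ioi s) s := by
  rw [hasDerivWithinAt_iff_tendsto_slope' (by simp), gen_S _ hf]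
  have hr : Tendsto (fun r : ℝ => (t - r).toNNReal) (𝓝[>] s) (𝓝 (t - s).toNNReal) := by
    have : Continuous fun r : ℝ => (t - r).toNNReal := by fun_prop
    exact (this.tendsto s).mono_left nhdsWithin_le_nhds
  -- Since `S(t-s)f = S(t-r)S(r-s)f`, the slope is `-S(t-r)` applied to the quotient of `f` at time
  -- `r - s`.
  refine ((T.continuous_S.tendsto ((t - s).toNNReal, T.gen f)).comp (hr.prodMk_nhds
    ((tendsto_quotient hf).comp (tendsto_toNNReal_sub s)))).neg.congr' ?_
  filter_upwards [Ioo_mem_nhdsGT hst] with r hr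
  have hrs : 0 ≤ r - s := sub_nonneg.2 hr.1.le
  have htr : 0 ≤ t - r := sub_nonneg.2 hr.2.le
  have e : (t - s).toNNReal = (t - r).toNNReal + (r - s).toNNReal := by
    rw [← Real.toNNReal_add htr hrs]; congr 1; ring
  simp only [Function.comp, slope, vsub_eq_sub, quotient, S_smul, S_sub, Real.coe_toNNReal _ hrs,
    ← S_comp, ← e]
  module

end FellerTransition

end DoobEntropy

end

/-! ### Markov measures on path space: marginals, uniqueness, change of initial law. -/

noncomputable section

namespace DoobEntropy

namespace FellerTransition

variable {E : Type*} [MetricSpace E] [CompactSpace E] [MeasurableSpace E] [BorelSpace E]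
  {T : FellerTransition E}

open CadlagPath

theorem stronglyMeasurable_eval {s t : ℝ≥0} (h : s ≤ t) :
    StronglyMeasurable[pathFiltration E t] (eval s : CadlagPath E → E) :=
  (Filtration.stronglyAdapted_natural
    (fun t => (measurable_eval (E := E) t).stronglyMeasurable) s).mono
    ((pathFiltration E).mono h)

theorem stronglyMeasurable_continuousMap_eval (G : C(E, ℝ)) {s t : ℝ≥0} (h : s ≤ t) :
    StronglyMeasurable[pathFiltration E t] fun X : CadlagPath E => G (X.eval s) :=
  G.continuous.comp_stronglyMeasurable (stronglyMeasurable_eval h)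

theorem measurable_continuousMap_eval (G : C(E, ℝ)) (s : ℝ≥0) :
    Measurable fun X : CadlagPath E => G (X.eval s) :=
  G.continuous.measurable.comp (measurable_eval s)

theorem integrable_mul_eval {P : Measure (CadlagPath E)} {W : CadlagPath E → ℝ}
    (hW : Integrable W P) (G : C(E, ℝ)) (s : ℝ≥0) :
    Integrable (fun X => W X * G (X.eval s)) P :=
  hW.mul_bdd (c := ‖G‖) (measurable_continuousMap_eval G s).aestronglyMeasurable
    (Eventually.of_forall fun _ => G.norm_coe_le_norm _)

theorem integrable_eval {P : Measure (CadlagPath E)} [IsFiniteMeasure P] (G : C(E, ℝ)) (s : ℝ≥0) :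
    Integrable (fun X => G (X.eval s)) P := by
  simpa using integrable_mul_eval (integrable_const (1 : ℝ)) G s

/-- The Markov property, tested against an integrable function of the past. -/
theorem IsMarkovMeasure.integral_mul_eval {μ : Measure E} {P : Measure (CadlagPath E)}
    (hP : T.IsMarkovMeasure μ P) {a b : ℝ≥0} (hab : a ≤ b) {W : CadlagPath E → ℝ}
    (hW : StronglyMeasurable[pathFiltration E a] W) (hWi : Integrable W P) (G : C(E, ℝ)) :
    ∫ X, W X * G (X.eval b) ∂P = ∫ X, W X * T.S (b - a) G (X.eval a) ∂P := by
  have := hP.isProb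
  have h1 := condExp_mul_of_stronglyMeasurable_left (μ := P) hW (integrable_mul_eval hWi G b)
    (integrable_eval G b)
  have h2 := hP.markov a (b - a) G
  rw [add_tsub_cancel_of_le hab] at h2
  have h3 : ∫ X, W X * G (X.eval b) ∂P = _ :=
    (integral_condExp ((pathFiltration E).le a)).symm
  rw [h3]
  refine integral_congr_ae ?_
  filter_upwards [h1, h2] with X e1 e2
  refine e1.trans ?_
  simp only [Pi.mul_apply, e2]

theorem IsMarkovMeasure.integrable_initial_iff {μ : Measure E} {P : Measure (CadlagPath E)}
    (hP : T.IsMarkovMeasure μ P) {ρ : E → ℝ} (hρ : Measurable ρ) :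
    Integrable ρ μ ↔ Integrable (fun X => ρ (X.eval 0)) P := by
  rw [← hP.initial, integrable_map_measure hρ.aestronglyMeasurable (measurable_eval 0).aemeasurable]
  rfl

/-- Two-time marginals of a Markov measure, weighted by a function of the initial point. -/
theorem IsMarkovMeasure.integral_two {μ : Measure E} {P : Measure (CadlagPath E)}
    (hP : T.IsMarkovMeasure μ P) {ρ : E → ℝ} (hρ : Measurable ρ) (hρi : Integrable ρ μ)
    {a b : ℝ≥0} (hab : a ≤ b) (G₁ G₂ : C(E, ℝ)) :
    ∫ X, ρ (X.eval 0) * G₁ (X.eval a) * G₂ (X.eval b) ∂P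
      = ∫ x, ρ x * T.S a (G₁ * T.S (b - a) G₂) x ∂μ := by
  have hρP := (hP.integrable_initial_iff hρ).1 hρi
  have hm : ∀ s, StronglyMeasurable[pathFiltration E s] fun X : CadlagPath E => ρ (X.eval 0) :=
    fun s => (hρ.comp (stronglyMeasurable_eval (zero_le : 0 ≤ s)).measurable).stronglyMeasurable
  have hW : StronglyMeasurable[pathFiltration E a]
      fun X : CadlagPath E => ρ (X.eval 0) * G₁ (X.eval a) :=
    (hm a).mul (stronglyMeasurable_continuousMap_eval G₁ le_rfl)
  rw [hP.integral_mul_eval hab hW (integrable_mul_eval hρP G₁ a)]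
  have h := hP.integral_mul_eval (zero_le : 0 ≤ a) (hm 0) hρP (G₁ * T.S (b - a) G₂)
  simp only [ContinuousMap.mul_apply, ← mul_assoc] at h
  rw [h, tsub_zero, ← hP.initial, integral_map (measurable_eval 0).aemeasurable]
  exact (hρ.mul (ContinuousMap.continuous _).measurable).aestronglyMeasurable

theorem IsMarkovMeasure.integral_one {μ : Measure E} {P : Measure (CadlagPath E)}
    (hP : T.IsMarkovMeasure μ P) {ρ : E → ℝ} (hρ : Measurable ρ) (hρi : Integrable ρ μ)
    (a : ℝ≥0) (G : C(E, ℝ)) :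
    ∫ X, ρ (X.eval 0) * G (X.eval a) ∂P = ∫ x, ρ x * T.S a G x ∂μ := by
  have h := hP.integral_two hρ hρi (le_refl a) G 1
  simpa [S_one] using h

variable (T) in
/-- The finite-dimensional distributions of a Markov measure depend on its initial law only. -/
theorem exists_integral_prod_eq (μ : Measure E) (I : Finset ℝ≥0) :
    ∀ f : ℝ≥0 → C(E, ℝ), ∃ c : ℝ, ∀ P : Measure (CadlagPath E), T.IsMarkovMeasure μ P →
      ∫ X, ∏ i ∈ I, f i (X.eval i) ∂P = c := by
  classical
  induction I using Finset.induction_on_max with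
  | empty => exact fun f => ⟨1, fun P hP => by have := hP.isProb; simp⟩
  | insert a s hs ih =>
    intro f
    have has : a ∉ s := fun h => lt_irrefl _ (hs a h)
    rcases s.eq_empty_or_nonempty with rfl | hne
    · refine ⟨∫ x, T.S a (f a) x ∂μ, fun P hP => ?_⟩
      have := hP.isProb
      have : IsProbabilityMeasure μ := by
        rw [← hP.initial]
        exact Measure.isProbabilityMeasure_map (measurable_eval 0).aemeasurable
      simpa using hP.integral_one (ρ := fun _ => 1) measurable_const (integrable_const _) a (f a)
    · set b := s.max' hne
      have hb : b ∈ s := s.max'_mem hne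
      -- Conditioning at `b`, the last time before `a`, removes the factor at `a` and multiplies the
      -- factor at `b` by `S(a-b)(f a)`.
      obtain ⟨c, hc⟩ := ih (Function.update f b (f b * T.S (a - b) (f a)))
      refine ⟨c, fun P hP => ?_⟩
      have := hP.isProb
      rw [← hc P hP]
      have hW : StronglyMeasurable[pathFiltration E b]
          fun X : CadlagPath E => ∏ i ∈ s, f i (X.eval i) :=
        Finset.stronglyMeasurable_fun_prod s fun i hi =>
          stronglyMeasurable_continuousMap_eval (f i) (s.le_max' i hi)
      have hWi : Integrable (fun X : CadlagPath E => ∏ i ∈ s, f i (X.eval i)) P := by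
        refine Integrable.of_bound (hW.mono ((pathFiltration E).le b)).aestronglyMeasurable
          (∏ i ∈ s, ‖f i‖) (Eventually.of_forall fun X => ?_)
        rw [norm_prod]
        exact Finset.prod_le_prod (fun _ _ => norm_nonneg _) fun i _ => (f i).norm_coe_le_norm _
      have h := hP.integral_mul_eval (hs b hb).le hW hWi (f a)
      simp only [Finset.prod_insert has]
      simp only [mul_comm (f a _)]
      rw [h]
      congr 1
      ext X
      rw [← Finset.mul_prod_erase s _ hb, ← Finset.mul_prod_erase s _ hb]
      have e : ∏ i ∈ s.erase b, (Function.update f b (f b * T.S (a - b) (f a)) i) (X.eval i)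
          = ∏ i ∈ s.erase b, f i (X.eval i) :=
        Finset.prod_congr rfl fun i hi => by rw [Function.update_of_ne (Finset.ne_of_mem_erase hi)]
      rw [e, Function.update_self]
      simp only [ContinuousMap.mul_apply]
      ring

theorem ext_of_integral_prod {ι : Type*} [Fintype ι] {P Q : Measure (ι → E)}
    [IsFiniteMeasure P] [IsFiniteMeasure Q]
    (h : ∀ f : ι → C(E, ℝ), ∫ x, ∏ i, f i (x i) ∂P = ∫ x, ∏ i, f i (x i) ∂Q) : P = Q := by
  -- The trivial factor `Unit` only serves to match the shape of the extensionality lemma, which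
  -- tests against products times a function of a second variable.
  have hm : Measurable fun x : ι → E => (x, ()) := by fun_prop
  have key : P.map (fun x => (x, ())) = Q.map (fun x => (x, ())) := by
    refine Measure.ext_of_integral_prod_mul_boundedContinuousFunction fun f g => ?_
    have hmeas : Measurable fun p : (ι → E) × Unit => (∏ i, f i (p.1 i)) * g p.2 :=
      (Finset.measurable_fun_prod _ fun i _ => (f i).continuous.measurable.comp
        ((measurable_pi_apply i).comp measurable_fst)).mul (by fun_prop)
    rw [integral_map hm.aemeasurable hmeas.aestronglyMeasurable,
      integral_map hm.aemeasurable hmeas.aestronglyMeasurable]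
    dsimp only
    rw [integral_mul_const, integral_mul_const]
    congr 1
    exact h fun i => (f i).toContinuousMap
  have h2 := congrArg (Measure.map Prod.fst) key
  rwa [Measure.map_map measurable_fst hm, Measure.map_map measurable_fst hm,
    show Prod.fst ∘ (fun x : ι → E => (x, ())) = id from rfl, Measure.map_id, Measure.map_id] at h2

/-- A Markov measure is determined by its transition function and its initial law. -/
theorem IsMarkovMeasure.unique {μ : Measure E} {P P' : Measure (CadlagPath E)}
    (hP : T.IsMarkovMeasure μ P) (hP' : T.IsMarkovMeasure μ P') : P = P' := by
  have := hP.isProb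
  have := hP'.isProb
  let v : CadlagPath E → ℝ≥0 → E := fun X t => X.eval t
  have hv : Measurable v := measurable_subtype_coe
  have hfin : ∀ I : Finset ℝ≥0, (P.map v).map I.restrict
      = (P'.map v).map I.restrict := by
    intro I
    have hr : Measurable (I.restrict : (ℝ≥0 → E) → _) := Finset.measurable_restrict I
    refine ext_of_integral_prod fun f => ?_
    have hmeas : Measurable fun x : I → E => ∏ i, f i (x i) :=
      Finset.measurable_fun_prod _ fun i _ => (f i).continuous.measurable.comp
        (measurable_pi_apply i)
    classical
    obtain ⟨c, hc⟩ := exists_integral_prod_eq T μ I fun i => if h : i ∈ I then f ⟨i, h⟩ else 0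
    have key : ∀ R : Measure (CadlagPath E), T.IsMarkovMeasure μ R →
        ∫ x, ∏ i, f i (x i) ∂((R.map v).map I.restrict) = c := by
      intro R hR
      rw [Measure.map_map hr hv, integral_map (hr.comp hv).aemeasurable
        hmeas.aestronglyMeasurable, ← hc R hR]
      congr 1
      ext X
      rw [← Finset.prod_coe_sort I]
      exact Finset.prod_congr rfl fun i _ => by rw [dif_pos i.2]; rfl
    rw [key P hP, key P' hP']
  have hmap : P.map v = P'.map v :=
    IsProjectiveLimit.unique (P := fun I => (P'.map v).map I.restrict)
      (fun I => hfin I) (fun I => rfl)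
  ext s hs
  -- The path σ-algebra is the trace of the product one, so equality of the images in `ℝ≥0 → E` is
  -- enough.
  obtain ⟨B, hB, rfl⟩ := hs
  change P (v ⁻¹' B) = P' (v ⁻¹' B)
  rw [← Measure.map_apply hv hB, hmap, Measure.map_apply hv hB]

/-- Changing the initial law by a density keeps the Markov property. -/
theorem IsMarkovMeasure.withDensity {μ : Measure E} {P : Measure (CadlagPath E)}
    (hP : T.IsMarkovMeasure μ P) {ρ : E → ℝ≥0} (hρ : Measurable ρ)
    (h1 : ∫⁻ x, ρ x ∂μ = 1) :
    T.IsMarkovMeasure (μ.withDensity fun x => ρ x)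
      (P.withDensity fun X => (ρ (X.eval 0) : ℝ≥0∞)) := by
  have := hP.isProb
  have hρE : Measurable fun x => (ρ x : ℝ≥0∞) := hρ.coe_nnreal_ennreal
  have hρ0 : Measurable fun X : CadlagPath E => ρ (X.eval 0) := hρ.comp (measurable_eval 0)
  have hlin : ∫⁻ X, (ρ (X.eval 0) : ℝ≥0∞) ∂P = 1 := by
    rw [← h1, ← hP.initial, lintegral_map hρE (measurable_eval 0)]
  have hprob : IsProbabilityMeasure (P.withDensity fun X => (ρ (X.eval 0) : ℝ≥0∞)) :=
    ⟨by rw [withDensity_apply _ .univ, Measure.restrict_univ, hlin]⟩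
  have hint : Integrable (fun X => (ρ (X.eval 0) : ℝ)) P := by
    have := (integrable_withDensity_iff_integrable_smul hρ0 (μ := P) (g := fun _ => (1 : ℝ))).1
      (integrable_const _)
    simpa [NNReal.smul_def] using this
  refine ⟨hprob, ?_, fun s r f => ?_⟩
  · ext B hB
    rw [Measure.map_apply (measurable_eval 0) hB, withDensity_apply _ hB,
      withDensity_apply _ (measurable_eval 0 hB), ← hP.initial,
      setLIntegral_map hB hρE (measurable_eval 0)]
  · symm
    refine ae_eq_condExp_of_forall_setIntegral_eq ((pathFiltration E).le s)
      (integrable_eval f _) (fun A _ _ => (integrable_eval _ _).integrableOn) (fun A hA _ => ?_)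
      (stronglyMeasurable_continuousMap_eval _ le_rfl).aestronglyMeasurable
    have hA' := (pathFiltration E).le s _ hA
    rw [setIntegral_withDensity_eq_setIntegral_smul hρ0 _ hA',
      setIntegral_withDensity_eq_setIntegral_smul hρ0 _ hA', ← integral_indicator hA',
      ← integral_indicator hA']
    -- The weight `ρ(X 0)` on `A` belongs to the past of `s`, so the Markov property of `P` applies
    -- with it as test function.
    have hWm : StronglyMeasurable[pathFiltration E s]
        (A.indicator fun X : CadlagPath E => (ρ (X.eval 0) : ℝ)) :=
      ((measurable_coe_nnreal_real.comp hρ).comp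
        (stronglyMeasurable_eval (zero_le : 0 ≤ s)).measurable).stronglyMeasurable.indicator hA
    have h := hP.integral_mul_eval (le_add_right le_rfl : s ≤ s + r) hWm (hint.indicator hA') f
    rw [add_tsub_cancel_left] at h
    have e : ∀ (g : C(E, ℝ)) (u : ℝ≥0) (X : CadlagPath E),
        A.indicator (fun X => ρ (X.eval 0) • g (X.eval u)) X
          = A.indicator (fun X => (ρ (X.eval 0) : ℝ)) X * g (X.eval u) := fun g u X => by
      by_cases hX : X ∈ A <;> simp [hX, NNReal.smul_def]
    simp only [e]
    exact h.symm

end FellerTransition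

end DoobEntropy

end

/-! ### Chain rule for `k log k` and the maximum principle behind the Lagrangian. -/

noncomputable section

namespace DoobEntropy

section Calculus

variable {E : Type*} [TopologicalSpace E]

@[simp] theorem expC_apply (f : C(E, ℝ)) (x : E) : expC f x = Real.exp (f x) := rfl

/-- The remainder equals `b log(b/a) - (b - a)`; `log x ≤ x - 1` at `a/b` gives nonnegativity and at
`b/a` the quadratic bound. -/
theorem mul_log_sub_mul_log_bound {a b c : ℝ} (hc : 0 < c) (ha : c ≤ a) (hb : 0 < b) :
    |b * Real.log b - a * Real.log a - (1 + Real.log a) * (b - a)| ≤ (b - a) ^ 2 / c := by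
  have ha0 : 0 < a := hc.trans_le ha
  have h1 : Real.log b - Real.log a ≤ b / a - 1 := by
    rw [← Real.log_div hb.ne' ha0.ne']
    exact Real.log_le_sub_one_of_pos (div_pos hb ha0)
  have h2 : Real.log a - Real.log b ≤ a / b - 1 := by
    rw [← Real.log_div ha0.ne' hb.ne']
    exact Real.log_le_sub_one_of_pos (div_pos ha0 hb)
  have e1 : b * (b / a - 1) = (b - a) ^ 2 / a + (b - a) := by field_simp; ring
  have e2 : b * (a / b - 1) = a - b := by field_simp
  have h1' := mul_le_mul_of_nonneg_left h1 hb.le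
  have h2' := mul_le_mul_of_nonneg_left h2 hb.le
  have h3 : (b - a) ^ 2 / a ≤ (b - a) ^ 2 / c := by gcongr
  rw [abs_of_nonneg (by nlinarith)]
  nlinarith

/-- The chain rule for `k log k` in the sup norm, where `k = e^g`. -/
theorem hasDerivWithinAt_mul_expC [CompactSpace E] {g : ℝ → C(E, ℝ)} {k' : C(E, ℝ)} {s : ℝ}
    {I : Set ℝ} (hk : HasDerivWithinAt (fun r => expC (g r)) k' I s) :
    HasDerivWithinAt (fun r => g r * expC (g r)) ((1 + g s) * k') I s := by
  -- `e^{g s}` is bounded below by this constant, which makes the quadratic remainder uniform in the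
  -- space variable.
  have hc : 0 < Real.exp (-‖g s‖) := Real.exp_pos _
  have hbound : ∀ r, ‖g r * expC (g r) - g s * expC (g s)
      - (1 + g s) * (expC (g r) - expC (g s))‖
        ≤ (Real.exp (-‖g s‖))⁻¹ * ‖expC (g r) - expC (g s)‖ ^ 2 := by
    intro r
    refine (ContinuousMap.norm_le _ (by positivity)).2 fun x => ?_
    have h := mul_log_sub_mul_log_bound (a := expC (g s) x) (b := expC (g r) x) hc
      (Real.exp_le_exp.2 (neg_le_of_abs_le ((g s).norm_coe_le_norm x))) (Real.exp_pos _)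
    simp only [expC_apply, Real.log_exp] at h
    rw [mul_comm (Real.exp (g r x)), mul_comm (Real.exp (g s x))] at h
    refine h.trans ?_
    rw [div_eq_inv_mul, ← sq_abs]
    gcongr
    exact (expC (g r) - expC (g s)).norm_coe_le_norm x
  rw [hasDerivWithinAt_iff_isLittleO] at hk ⊢
  have hO : (fun r => expC (g r) - expC (g s)) =O[𝓝[I] s] fun r => r - s := by
    have h2 : (fun r : ℝ => (r - s) • k') =O[𝓝[I] s] fun r => r - s :=
      Asymptotics.isBigO_of_le' (c := ‖k'‖) _ fun r => by rw [norm_smul, mul_comm]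
    exact (hk.isBigO.add h2).congr_left fun r => by abel
  have h1 : (fun r => g r * expC (g r) - g s * expC (g s)
      - (1 + g s) * (expC (g r) - expC (g s))) =o[𝓝[I] s] fun r => r - s := by
    have ha : (fun r => g r * expC (g r) - g s * expC (g s)
      - (1 + g s) * (expC (g r) - expC (g s)))
        =O[𝓝[I] s] fun r => ‖expC (g r) - expC (g s)‖ ^ 2 :=
      Asymptotics.isBigO_of_le' (c := (Real.exp (-‖g s‖))⁻¹) _ fun r => by
        rw [norm_pow, norm_norm]; exact hbound r
    have hb : (fun r => ‖expC (g r) - expC (g s)‖ ^ 2) =O[𝓝[I] s] fun r => (r - s) ^ 2 :=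
      hO.norm_left.pow 2
    refine (ha.trans hb).trans_isLittleO ?_
    have hz : Tendsto (fun r : ℝ => r - s) (𝓝[I] s) (𝓝 0) := by
      have : Continuous fun r : ℝ => r - s := by fun_prop
      simpa using (this.tendsto s).mono_left (nhdsWithin_le_nhds (s := I))
    have := ((Asymptotics.isLittleO_one_iff ℝ).2 hz).mul_isBigO
      (Asymptotics.isBigO_refl (fun r : ℝ => r - s) (𝓝[I] s))
    simpa [sq] using this
  have h2 : (fun r => (1 + g s) * (expC (g r) - expC (g s) - (r - s) • k'))
      =o[𝓝[I] s] fun r => r - s := by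
    refine Asymptotics.IsBigO.trans_isLittleO ?_ hk
    exact Asymptotics.isBigO_of_le' (c := ‖1 + g s‖) _ fun r => norm_mul_le _ _
  refine (h1.add h2).congr_left fun r => ?_
  simp only [mul_sub, mul_smul_comm]
  abel

end Calculus

variable {E : Type*} [MetricSpace E] [CompactSpace E] [MeasurableSpace E] [BorelSpace E]

open FellerTransition

/-- Integration against a finite measure, as a continuous functional on `C(E)`. -/
def integralCLM (m : Measure E) [IsFiniteMeasure m] : C(E, ℝ) →L[ℝ] ℝ :=
  LinearMap.mkContinuous
    { toFun := fun f => ∫ x, f x ∂m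
      map_add' := fun f g => integral_add (integrable_continuousMap f) (integrable_continuousMap g)
      map_smul' := fun c f => integral_const_mul c _ } (m.real Set.univ) fun f => by
    rw [mul_comm]
    exact norm_integral_le_of_norm_le_const (Eventually.of_forall fun x => f.norm_coe_le_norm x)

theorem integralCLM_apply (m : Measure E) [IsFiniteMeasure m] (f : C(E, ℝ)) :
    integralCLM m f = ∫ x, f x ∂m := rfl

theorem integralCLM_mono (m : Measure E) [IsFiniteMeasure m] {f g : C(E, ℝ)}
    (h : ∀ x, f x ≤ g x) : integralCLM m f ≤ integralCLM m g :=
  integral_mono (integrable_continuousMap f) (integrable_continuousMap g) h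

namespace FellerTransition

variable {T : FellerTransition E}

theorem S_mono (t : ℝ≥0) {f g : C(E, ℝ)} (h : ∀ x, f x ≤ g x) (x : E) : T.S t f x ≤ T.S t g x := by
  have := T.S_nonneg t (f := g - f) (fun y => sub_nonneg.2 (h y)) x
  rw [S_sub] at this
  exact sub_nonneg.1 this

theorem expC_V (t : ℝ≥0) (f : C(E, ℝ)) : expC (T.V t f) = T.S t (expC f) := by
  ext x
  exact Real.exp_log (T.S_expC_pos t f x)

theorem V_zero_apply (f : C(E, ℝ)) : T.V 0 f = f := by
  ext x
  change Real.log (T.S 0 (expC f) x) = f x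
  rw [S_zero_apply, expC_apply, Real.log_exp]

/-- The functional `f ↦ e^{-g}(A(f e^g) - f A e^g) - e^{-f} A e^f`, multiplied by `e^g`, is
maximal at `f = g`. -/
theorem gen_mul_sub_le {f g : C(E, ℝ)} (h1 : expC f ∈ T.genDomain) (h2 : expC g ∈ T.genDomain)
    (h3 : f * expC g ∈ T.genDomain) (h4 : g * expC g ∈ T.genDomain) (x : E) :
    (T.gen (f * expC g) - f * T.gen (expC g) - T.hamiltonian f * expC g) x
      ≤ (T.gen (g * expC g) - (1 + g) * T.gen (expC g)) x := by
  -- With `d = (f - f x) - (g - g x)`, this is `φ = e^g (e^d - 1 - d)`: nonnegative, and zero at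
  -- `x`. The claim is `Aφ(x) ≥ 0`.
  set φ : C(E, ℝ) := Real.exp (g x - f x) • expC f + (-1 : ℝ) • (f * expC g) + (1 : ℝ) • (g * expC g)
    + (f x - g x - 1) • expC g with hφ
  have hlim := tendsto_quotient_add (tendsto_quotient_add (tendsto_quotient_add
    (tendsto_quotient_smul (Real.exp (g x - f x)) (tendsto_quotient h1))
    (tendsto_quotient_smul (-1) (tendsto_quotient h3)))
    (tendsto_quotient_smul 1 (tendsto_quotient h4)))
    (tendsto_quotient_smul (f x - g x - 1) (tendsto_quotient h2))
  have hnn : ∀ y, 0 ≤ φ y := by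
    intro y
    have h := Real.add_one_le_exp ((f y - f x) - (g y - g x))
    have e1 : Real.exp (g x - f x) * Real.exp (f y)
        = Real.exp (g y) * Real.exp ((f y - f x) - (g y - g x)) := by
      rw [← Real.exp_add, ← Real.exp_add]; congr 1; ring
    simp only [hφ, ContinuousMap.add_apply, ContinuousMap.smul_apply, ContinuousMap.mul_apply,
      expC_apply, smul_eq_mul, e1]
    nlinarith [Real.exp_pos (g y)]
  have hx : φ x = 0 := by
    have e1 : Real.exp (g x - f x) * Real.exp (f x) = Real.exp (g x) := by
      rw [← Real.exp_add]; congr 1; ring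
    simp only [hφ, ContinuousMap.add_apply, ContinuousMap.smul_apply, ContinuousMap.mul_apply,
      expC_apply, smul_eq_mul, e1]
    ring
  have h := gen_nonneg_of_isMin ⟨_, hlim⟩ hnn hx
  rw [gen_eq hlim] at h
  have e2 : Real.exp (g x - f x) = Real.exp (-f x) * Real.exp (g x) := by
    rw [← Real.exp_add]; congr 1; ring
  simp only [ContinuousMap.add_apply, ContinuousMap.smul_apply, smul_eq_mul, e2] at h
  simp only [hamiltonian, ContinuousMap.sub_apply, ContinuousMap.mul_apply, ContinuousMap.add_apply,
    ContinuousMap.one_apply, expC_apply, ContinuousMap.neg_apply]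
  nlinarith

theorem hamiltonian_mul_expC (g : C(E, ℝ)) : T.hamiltonian g * expC g = T.gen (expC g) := by
  ext x
  simp only [hamiltonian, ContinuousMap.mul_apply, expC_apply, ContinuousMap.neg_apply]
  rw [mul_right_comm, ← Real.exp_add, neg_add_cancel, Real.exp_zero, one_mul]

theorem hamiltonian_zero : T.hamiltonian 0 = 0 := by
  have : expC (0 : C(E, ℝ)) = 1 := by ext x; simp
  rw [hamiltonian, this, gen_one, mul_zero]

variable (T)

/-- The space-time harmonic function `S(t - s) e^h`. -/
def tilt (h : C(E, ℝ)) (t : ℝ≥0) (s : ℝ) : C(E, ℝ) := T.S (t - s).toNNReal (expC h)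

/-- The logarithm `V(t - s) h` of the space-time harmonic function. -/
def logTilt (h : C(E, ℝ)) (t : ℝ≥0) (s : ℝ) : C(E, ℝ) := T.V (t - s).toNNReal h

/-- The Doob-transformed generator applied to `f`, multiplied by the harmonic function. -/
def drift (h : C(E, ℝ)) (t : ℝ≥0) (f : C(E, ℝ)) (s : ℝ) : C(E, ℝ) :=
  T.gen (f * T.tilt h t s) - f * T.gen (T.tilt h t s)

theorem expC_logTilt (h : C(E, ℝ)) (t : ℝ≥0) (s : ℝ) :
    expC (T.logTilt h t s) = T.tilt h t s := expC_V _ _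

end FellerTransition

end DoobEntropy

end

/-! ### Curves in the core and the derivatives of the Doob transform. -/

noncomputable section

namespace DoobEntropy

variable {E : Type*} [MetricSpace E] [CompactSpace E] [MeasurableSpace E] [BorelSpace E]

open FellerTransition CoreSpace

namespace IsTopologicalCore

variable {T : FellerTransition E} {D : Submodule ℝ C(E, ℝ)} [TopologicalSpace (CoreSpace D)]

theorem incl_mem (f : CoreSpace D) : incl D f ∈ D := (show D from f).2

theorem expC_mem (hD : IsTopologicalCore T D) {f : C(E, ℝ)} (hf : f ∈ D) : expC f ∈ D :=
  hD.comp_mem f hf Real.exp Real.contDiff_exp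

/-- A continuous curve in `(D, τ_D)`, as a property of the underlying curve in `C(E)`. -/
def IsCoreCurve (D : Submodule ℝ C(E, ℝ)) [TopologicalSpace (CoreSpace D)] (c : ℝ → C(E, ℝ)) :
    Prop :=
  ∃ d : ℝ → CoreSpace D, (∀ s, incl D (d s) = c s) ∧ Continuous d

theorem IsCoreCurve.mem {c : ℝ → C(E, ℝ)} (hc : IsCoreCurve D c) (s : ℝ) : c s ∈ D := by
  obtain ⟨d, hd, -⟩ := hc
  rw [← hd s]
  exact incl_mem _

theorem isCoreCurve_const {f : C(E, ℝ)} (hf : f ∈ D) : IsCoreCurve D fun _ => f :=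
  ⟨fun _ => (⟨f, hf⟩ : D), fun _ => rfl, continuous_const⟩

theorem isCoreCurve_of_restricts {W : ℝ≥0 → C(E, ℝ) → C(E, ℝ)}
    (hW : RestrictsStronglyContinuously D W) {f : C(E, ℝ)} (hf : f ∈ D) {a : ℝ → ℝ≥0}
    (ha : Continuous a) : IsCoreCurve D fun s => W (a s) f := by
  obtain ⟨w, hw, -, hc⟩ := hW
  exact ⟨fun s => w (a s) (⟨f, hf⟩ : D), fun s => hw (a s) (⟨f, hf⟩ : D), (hc _).comp ha⟩

theorem isCoreCurve_mul (hD : IsTopologicalCore T D) {c d : ℝ → C(E, ℝ)} (hc : IsCoreCurve D c)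
    (hd : IsCoreCurve D d) : IsCoreCurve D fun s => c s * d s := by
  obtain ⟨m, hm, hmc⟩ := hD.mul_continuous
  obtain ⟨c', hc', hcc⟩ := hc
  obtain ⟨d', hd', hdc⟩ := hd
  exact ⟨fun s => m (c' s, d' s), fun s => by rw [hm, hc', hd'], hmc.comp (hcc.prodMk hdc)⟩

theorem continuous_curve (hD : IsTopologicalCore T D) {c : ℝ → C(E, ℝ)} (hc : IsCoreCurve D c) :
    Continuous c := by
  obtain ⟨d, hd, hdc⟩ := hc
  rw [← funext hd]
  exact hD.finer.comp hdc

/-- Continuity of `A` is assumed for `τ_D` rather than for the sup norm, so curves must be followed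
in `τ_D` before applying the generator. -/
theorem continuous_gen_curve (hD : IsTopologicalCore T D) {c : ℝ → C(E, ℝ)}
    (hc : IsCoreCurve D c) : Continuous fun s => T.gen (c s) := by
  obtain ⟨d, hd, hdc⟩ := hc
  rw [← funext hd]
  exact hD.gen_continuous.comp hdc

theorem isCoreCurve_tilt (hD : IsTopologicalCore T D) {h : C(E, ℝ)} (hh : h ∈ D) (t : ℝ≥0) :
    IsCoreCurve D (T.tilt h t) :=
  isCoreCurve_of_restricts hD.S_restricts (hD.expC_mem hh)
    (continuous_real_toNNReal.comp (continuous_const.sub continuous_id))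

theorem isCoreCurve_logTilt (hD : IsTopologicalCore T D) {h : C(E, ℝ)} (hh : h ∈ D) (t : ℝ≥0) :
    IsCoreCurve D (T.logTilt h t) :=
  isCoreCurve_of_restricts hD.V_restricts hh
    (continuous_real_toNNReal.comp (continuous_const.sub continuous_id))

theorem continuous_drift (hD : IsTopologicalCore T D) {h : C(E, ℝ)} (hh : h ∈ D) (t : ℝ≥0)
    {f : C(E, ℝ)} (hf : f ∈ D) : Continuous (T.drift h t f) :=
  (hD.continuous_gen_curve (hD.isCoreCurve_mul (isCoreCurve_const hf)
    (hD.isCoreCurve_tilt hh t))).sub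
      (continuous_const.mul (hD.continuous_gen_curve (hD.isCoreCurve_tilt hh t)))

theorem hasDerivWithinAt_tilt (hD : IsTopologicalCore T D) {h : C(E, ℝ)} (hh : h ∈ D) {t : ℝ≥0}
    {s : ℝ} (hs : s < t) :
    HasDerivWithinAt (T.tilt h t) (-T.gen (T.tilt h t s)) (Set.Ioi s) s :=
  hasDerivWithinAt_S_sub (hD.subset_domain _ (hD.expC_mem hh)) hs

/-- The forward motion of `S(r)` contributes `A(f k)`, the backward equation `k' = -A k` contributes
`-f A k`. -/
theorem hasDerivWithinAt_S_mul_tilt (hD : IsTopologicalCore T D) {h : C(E, ℝ)} (hh : h ∈ D)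
    {t : ℝ≥0} {f : C(E, ℝ)} (hf : f ∈ D) {s : ℝ} (hs0 : 0 ≤ s) (hs : s < t) :
    HasDerivWithinAt (fun r : ℝ => T.S r.toNNReal (f * T.tilt h t r))
      (T.S s.toNNReal (T.drift h t f s)) (Set.Ioi s) s := by
  have := hasDerivWithinAt_S hs0 ((hD.hasDerivWithinAt_tilt hh hs).const_mul f)
    (hD.subset_domain _ (hD.mul_mem _ hf _ ((hD.isCoreCurve_tilt hh t).mem s)))
  rwa [mul_neg, ← sub_eq_add_neg] at this

theorem hasDerivWithinAt_S_mul_logTilt (hD : IsTopologicalCore T D) {h : C(E, ℝ)} (hh : h ∈ D)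
    {t : ℝ≥0} {s : ℝ} (hs0 : 0 ≤ s) (hs : s < t) :
    HasDerivWithinAt (fun r : ℝ => T.S r.toNNReal (T.logTilt h t r * T.tilt h t r))
      (T.S s.toNNReal (T.gen (T.logTilt h t s * T.tilt h t s)
        - (1 + T.logTilt h t s) * T.gen (T.tilt h t s))) (Set.Ioi s) s := by
  have hk := hD.hasDerivWithinAt_tilt hh hs
  have hg := hasDerivWithinAt_mul_expC (g := T.logTilt h t)
    (by simpa only [expC_logTilt] using hk)
  simp only [expC_logTilt] at hg
  have := hasDerivWithinAt_S hs0 hg (hD.subset_domain _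
    (hD.mul_mem _ ((hD.isCoreCurve_logTilt hh t).mem s) _ ((hD.isCoreCurve_tilt hh t).mem s)))
  rwa [mul_neg, ← sub_eq_add_neg] at this

/-- The functional `f ↦ ⟨S(s) (A(f k) - f A k), m⟩` on `D`, where `k = S(t - s) e^h`. -/
def driftFunctional (hD : IsTopologicalCore T D) {h : C(E, ℝ)} (hh : h ∈ D) (t : ℝ≥0)
    (m : Measure E) [IsFiniteMeasure m] (s : ℝ≥0) : CoreSpace D →L[ℝ] ℝ where
  toFun f := integralCLM m (T.S s (T.drift h t (incl D f) s))
  map_add' f g := by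
    have hk := (hD.isCoreCurve_tilt hh t).mem s
    have hf := hD.subset_domain _ (hD.mul_mem _ (incl_mem f) _ hk)
    have hg := hD.subset_domain _ (hD.mul_mem _ (incl_mem g) _ hk)
    rw [← map_add, ← S_add]
    congr 2
    have := gen_add hf hg
    rw [← add_mul] at this
    simp only [drift, map_add]
    refine Eq.trans (congrArg (· - _) this) ?_
    rw [add_mul]
    exact add_sub_add_comm _ _ _ _
  map_smul' c f := by
    have hk := (hD.isCoreCurve_tilt hh t).mem s
    have hf := hD.subset_domain _ (hD.mul_mem _ (incl_mem f) _ hk)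
    rw [RingHom.id_apply, ← map_smul, ← S_smul]
    congr 2
    have := gen_smul c hf
    rw [← smul_mul_assoc] at this
    simp only [drift, map_smul]
    refine Eq.trans (congrArg (· - _) this) ?_
    rw [smul_mul_assoc, smul_sub]
  cont := by
    obtain ⟨μ, hμ, hμc⟩ := hD.mul_continuous
    obtain ⟨d, hd, -⟩ := hD.isCoreCurve_tilt hh t
    have h1 : Continuous fun f : CoreSpace D => T.drift h t (incl D f) s := by
      have h2 := hD.gen_continuous.comp (hμc.comp
        (continuous_id.prodMk (continuous_const (y := d s))))
      simp only [Function.comp_def, hμ, hd, id] at h2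
      exact h2.sub (hD.finer.mul continuous_const)
    exact (integralCLM m).continuous.comp (T.continuous_S_comp continuous_const h1)

/-- The functional `f ↦ ⟨A f, μ⟩` on `D`. -/
def genFunctional (hD : IsTopologicalCore T D) (m : Measure E) [IsFiniteMeasure m] :
    CoreSpace D →L[ℝ] ℝ where
  toFun f := integralCLM m (T.gen (incl D f))
  map_add' f g := by
    rw [map_add, gen_add (hD.subset_domain _ (incl_mem f))
      (hD.subset_domain _ (incl_mem g)), map_add]
  map_smul' c f := by
    rw [map_smul, gen_smul c (hD.subset_domain _ (incl_mem f)), map_smul, RingHom.id_apply]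
  cont := (integralCLM m).continuous.comp hD.gen_continuous

end IsTopologicalCore

end DoobEntropy

end

/-! ### Tilted curves: velocity, uniqueness of derivatives, and action. -/

noncomputable section

namespace DoobEntropy

variable {E : Type*} [MetricSpace E] [CompactSpace E] [MeasurableSpace E] [BorelSpace E]

open FellerTransition CoreSpace

/-- The operator `S(t)` as a continuous linear map. -/
def FellerTransition.semigroupCLM (T : FellerTransition E) (t : ℝ≥0) : C(E, ℝ) →L[ℝ] C(E, ℝ) :=
  LinearMap.mkContinuous
    { toFun := T.S t
      map_add' := T.S_add t
      map_smul' := T.S_smul t } 1 fun f => by simpa using T.norm_S_le t f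

/-- `ν` is the curve of one-time marginals of the Markov process weighted by `e^{h(X(t))}`, where
`m` is the weighted initial measure. -/
def IsTiltedCurve (T : FellerTransition E) (h : C(E, ℝ)) (t : ℝ≥0) (m : Measure E)
    [IsFiniteMeasure m] (ν : ℝ≥0 → ProbabilityMeasure E) : Prop :=
  -- Truncated subtraction merges both regimes: `s - t = 0` before time `t`, and `t - s = 0` after
  -- it.
  ∀ (s : ℝ≥0) (F : C(E, ℝ)), ∫ x, F x ∂(ν s : Measure E)
    = integralCLM m (T.S (min s t) (T.S (t - s) (expC h) * T.S (s - t) F))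

namespace IsTiltedCurve

variable {T : FellerTransition E} {D : Submodule ℝ C(E, ℝ)} [TopologicalSpace (CoreSpace D)]
  {h : C(E, ℝ)} {t : ℝ≥0} {m : Measure E} [IsFiniteMeasure m] {ν : ℝ≥0 → ProbabilityMeasure E}

theorem integral_of_le (hν : IsTiltedCurve T h t m ν) {s : ℝ≥0} (hs : s ≤ t) (F : C(E, ℝ)) :
    ∫ x, F x ∂(ν s : Measure E) = integralCLM m (T.S s (F * T.tilt h t s)) := by
  rw [hν, min_eq_left hs, tsub_eq_zero_of_le hs, S_zero_apply, mul_comm, tilt,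
    ← NNReal.coe_sub hs, Real.toNNReal_coe]

theorem integral_of_ge (hν : IsTiltedCurve T h t m ν) {s : ℝ≥0} (hs : t ≤ s) (F : C(E, ℝ)) :
    ∫ x, F x ∂(ν s : Measure E) = integralCLM m (T.S t (expC h * T.S (s - t) F)) := by
  rw [hν, min_eq_right hs, tsub_eq_zero_of_le hs, S_zero_apply]

theorem continuous_integral (hν : IsTiltedCurve T h t m ν) (F : C(E, ℝ)) :
    Continuous fun s => ∫ x, F x ∂(ν s : Measure E) := by
  simp only [hν _ F]
  refine (integralCLM m).continuous.comp (T.continuous_S_comp (by fun_prop) ?_)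
  exact (T.continuous_S_comp (by fun_prop) continuous_const).mul
    (T.continuous_S_comp (by fun_prop) continuous_const)

theorem continuous (hν : IsTiltedCurve T h t m ν) : Continuous ν := by
  refine continuous_iff_continuousAt.2 fun s => ?_
  refine ProbabilityMeasure.tendsto_iff_forall_integral_tendsto.2 fun f => ?_
  exact (hν.continuous_integral f.toContinuousMap).tendsto s

/-- The derivative of a tilted curve. -/
def velocity (hD : IsTopologicalCore T D) (hh : h ∈ D) (t : ℝ≥0) (m : Measure E)
    [IsFiniteMeasure m] (ν : ℝ≥0 → ProbabilityMeasure E) (s : ℝ≥0) : CoreSpace D →L[ℝ] ℝ :=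
  -- From time `t` on the tilt no longer acts, and the curve follows the untilted forward equation.
  if s < t then hD.driftFunctional hh t m s else hD.genFunctional (ν s : Measure E)

theorem hasDerivWithinAt_integral (hν : IsTiltedCurve T h t m ν) (hD : IsTopologicalCore T D)
    (hh : h ∈ D) (f : CoreSpace D) {s : ℝ} (hs : 0 ≤ s) :
    HasDerivWithinAt (fun r : ℝ => ∫ x, incl D f x ∂(ν r.toNNReal : Measure E))
      (velocity hD hh t m ν s.toNNReal f) (Set.Ioi s) s := by
  have hf := IsTopologicalCore.incl_mem f
  by_cases hst : s < t
  · have h1 := (integralCLM m).hasFDerivAt.comp_hasDerivWithinAt s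
      (hD.hasDerivWithinAt_S_mul_tilt hh hf hs hst)
    have hlt : s.toNNReal < t := by rwa [Real.toNNReal_lt_iff_lt_coe hs]
    have key : ∀ r ∈ Set.Ico s t, ∫ x, incl D f x ∂(ν r.toNNReal : Measure E)
        = integralCLM m (T.S r.toNNReal (incl D f * T.tilt h t r)) := fun r hr => by
      have hr0 := hs.trans hr.1
      rw [hν.integral_of_le (Real.toNNReal_le_iff_le_coe.2 hr.2.le), Real.coe_toNNReal _ hr0]
    have e : velocity hD hh t m ν s.toNNReal f
        = integralCLM m (T.S s.toNNReal (T.drift h t (incl D f) s)) := by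
      rw [velocity, if_pos hlt]
      change integralCLM m (T.S s.toNNReal (T.drift h t (incl D f) _)) = _
      rw [Real.coe_toNNReal _ hs]
    rw [e]
    refine h1.congr_of_eventuallyEq ?_ (key s ⟨le_rfl, hst⟩)
    filter_upwards [Ioo_mem_nhdsGT hst] with r hr using key r ⟨hr.1.le, hr.2⟩
  -- Here `⟨f, ν(r)⟩ = ⟨S(t)(e^h S(r-t)f), m⟩`, where only the innermost semigroup depends on `r`.
  · push Not at hst
    have hge : t ≤ s.toNNReal := by rwa [Real.le_toNNReal_iff_coe_le hs]
    have hx : 0 ≤ s - t := sub_nonneg.2 hst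
    have h0 := hasDerivWithinAt_S hx (hasDerivWithinAt_const (s - (t : ℝ)) _ (incl D f))
      (hD.subset_domain _ hf)
    have h1 : HasDerivWithinAt (fun r : ℝ => T.S (r - t).toNNReal (incl D f))
        (T.S (s - t).toNNReal (T.gen (incl D f))) (Set.Ioi s) s := by
      have hmaps : Set.MapsTo (fun r : ℝ => r - t) (Set.Ioi s) (Set.Ioi (s - t)) :=
        fun r hr => Set.mem_Ioi.2 (sub_lt_sub_right (Set.mem_Ioi.1 hr) _)
      have := HasDerivWithinAt.scomp s h0 (((hasDerivAt_id s).sub_const (t : ℝ)).hasDerivWithinAt)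
        hmaps
      rwa [add_zero, one_smul] at this
    have h2 := ((integralCLM m).comp (T.semigroupCLM t)).hasFDerivAt.comp_hasDerivWithinAt s
      (h1.const_mul (expC h))
    have key : ∀ r, s ≤ r → ∀ F : C(E, ℝ), ∫ x, F x ∂(ν r.toNNReal : Measure E)
        = integralCLM m (T.S t (expC h * T.S (r - t).toNNReal F)) := fun r hr F => by
      rw [hν.integral_of_ge (hge.trans (Real.toNNReal_le_toNNReal hr)),
        NNReal.sub_def, Real.coe_toNNReal _ (hs.trans hr)]
    have e : velocity hD hh t m ν s.toNNReal f
        = integralCLM m (T.S t (expC h * T.S (s - t).toNNReal (T.gen (incl D f)))) := by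
      rw [velocity, if_neg (not_lt.2 hge), ← key s le_rfl]
      rfl
    rw [e]
    refine h2.congr_of_eventuallyEq ?_ (key s le_rfl _)
    filter_upwards [self_mem_nhdsWithin] with r hr using key r (le_of_lt hr) _

/-- The velocity may jump at `t`, but it is glued from two continuous functions; the sum of their
norms is a continuous majorant. -/
theorem measurable_velocity (hν : IsTiltedCurve T h t m ν) (hD : IsTopologicalCore T D)
    (hh : h ∈ D) (f : CoreSpace D) :
    Measurable (fun s : ℝ => velocity hD hh t m ν s.toNNReal f) ∧
      ∃ B : ℝ → ℝ, Continuous B ∧ ∀ s : ℝ, ‖velocity hD hh t m ν s.toNNReal f‖ ≤ B s := by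
  have hf := IsTopologicalCore.incl_mem f
  have h1 : Continuous fun s : ℝ => hD.driftFunctional hh t m s.toNNReal f :=
    (integralCLM m).continuous.comp (T.continuous_S_comp continuous_real_toNNReal
      ((hD.continuous_drift hh t hf).comp
        (NNReal.continuous_coe.comp continuous_real_toNNReal)))
  have h2 : Continuous fun s : ℝ => hD.genFunctional (ν s.toNNReal : Measure E) f :=
    (hν.continuous_integral (T.gen (incl D f))).comp continuous_real_toNNReal
  have e : (fun s : ℝ => velocity hD hh t m ν s.toNNReal f)
      = fun s : ℝ => if s.toNNReal < t then hD.driftFunctional hh t m s.toNNReal f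
        else hD.genFunctional (ν s.toNNReal : Measure E) f := by
    ext s
    unfold velocity
    split_ifs <;> rfl
  refine ⟨?_, fun s => ‖hD.driftFunctional hh t m s.toNNReal f‖
    + ‖hD.genFunctional (ν s.toNNReal : Measure E) f‖, h1.norm.add h2.norm, fun s => ?_⟩
  · rw [e]
    exact Measurable.ite (measurableSet_lt measurable_real_toNNReal measurable_const)
      h1.measurable h2.measurable
  · rw [congrFun e s]
    split_ifs
    · exact le_add_of_nonneg_right (norm_nonneg _)
    · exact le_add_of_nonneg_left (norm_nonneg _)

theorem isDerivativeOf_velocity (hν : IsTiltedCurve T h t m ν) (hD : IsTopologicalCore T D)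
    (hh : h ∈ D) : IsDerivativeOf (velocity hD hh t m ν) ν := by
  have hint : ∀ (f : CoreSpace D) (r : ℝ),
      IntegrableOn (fun s : ℝ => velocity hD hh t m ν s.toNNReal f) (Set.Icc 0 r) := by
    intro f r
    obtain ⟨hm, B, hB, hle⟩ := hν.measurable_velocity hD hh f
    exact (hB.integrableOn_Icc).mono' hm.aestronglyMeasurable (Eventually.of_forall hle)
  refine ⟨fun f => (hν.measurable_velocity hD hh f).1.aemeasurable, fun f r => (hint f r).2,
    fun f r => ?_⟩
  rw [integral_Icc_eq_integral_Ioc, ← intervalIntegral.integral_of_le r.coe_nonneg]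
  have hc : Continuous fun r : ℝ => ∫ x, incl D f x ∂(ν r.toNNReal : Measure E) :=
    (hν.continuous_integral (incl D f)).comp continuous_real_toNNReal
  have := intervalIntegral.integral_eq_sub_of_hasDeriv_right_of_le r.coe_nonneg hc.continuousOn
    (fun s hs => hν.hasDerivWithinAt_integral hD hh f hs.1.le)
    ((intervalIntegrable_iff_integrableOn_Icc_of_le r.coe_nonneg).2 (hint f r))
  refine Eq.trans ?_ this.symm
  rw [Real.toNNReal_zero, Real.toNNReal_coe]

end IsTiltedCurve

/-- Two derivatives of the same curve agree almost everywhere. -/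
theorem IsDerivativeOf.ae_eq {T : FellerTransition E} {D : Submodule ℝ C(E, ℝ)}
    [TopologicalSpace (CoreSpace D)] (hD : IsTopologicalCore T D)
    {ν : ℝ≥0 → ProbabilityMeasure E} {u v : ℝ≥0 → CoreSpace D →L[ℝ] ℝ}
    (hu : IsDerivativeOf u ν) (hv : IsDerivativeOf v ν) (r : ℝ≥0) :
    ∀ᵐ s : ℝ ∂volume.restrict (Set.Icc 0 (r : ℝ)), u s.toNNReal = v s.toNNReal := by
  have hint : ∀ {w : ℝ≥0 → CoreSpace D →L[ℝ] ℝ}, IsDerivativeOf w ν → ∀ (f : CoreSpace D)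
      (x : ℝ≥0), IntegrableOn (fun s : ℝ => w s.toNNReal f) (Set.Icc 0 (x : ℝ)) := fun hw f x =>
    ⟨((hw.measurable f).mono_measure (Measure.restrict_mono Set.Icc_subset_Ici_self
      le_rfl)).aestronglyMeasurable, hw.integrable f x⟩
  have hone : ∀ f : CoreSpace D, ∀ᵐ s : ℝ ∂volume.restrict (Set.Icc 0 (r : ℝ)),
      u s.toNNReal f = v s.toNNReal f := by
    intro f
    have hz : ∀ x : ℝ, 0 ≤ x → ∫ s in (0 : ℝ)..x, (u s.toNNReal f - v s.toNNReal f) = 0 := by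
      intro x hx
      lift x to ℝ≥0 using hx
      rw [intervalIntegral.integral_of_le x.coe_nonneg, ← integral_Icc_eq_integral_Ioc,
        integral_sub (hint hu f x) (hint hv f x), ← hu.integral_eq, ← hv.integral_eq, sub_self]
    have hii : IntervalIntegrable (fun s : ℝ => u s.toNNReal f - v s.toNNReal f) volume 0 r :=
      (intervalIntegrable_iff_integrableOn_Icc_of_le r.coe_nonneg).2 ((hint hu f r).sub (hint hv f r))
    -- The primitive is known to vanish only on `[0, ∞)`, so a two-sided derivative can be read off
    -- only at `s > 0`.
    have h0 : ∀ᵐ s : ℝ, s ≠ 0 := by simp [ae_iff, measure_singleton]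
    rw [ae_restrict_iff' measurableSet_Icc]
    filter_upwards [hii.ae_hasDerivAt_integral, h0] with s hs hs0 hmem
    rw [Set.uIcc_of_le r.coe_nonneg] at hs
    have h1 := hs hmem 0 ⟨le_rfl, r.coe_nonneg⟩
    have hpos : 0 < s := lt_of_le_of_ne hmem.1 (Ne.symm hs0)
    have h2 : HasDerivAt (fun x => ∫ s in (0 : ℝ)..x, (u s.toNNReal f - v s.toNNReal f)) 0 s := by
      refine (hasDerivAt_const s (0 : ℝ)).congr_of_eventuallyEq ?_
      filter_upwards [lt_mem_nhds hpos] with x hx using hz x hx.le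
    exact sub_eq_zero.1 (h1.unique h2)
  -- The null set above depends on `f`. A countable dense set of test functions gives a common one,
  -- and continuity of the functionals does the rest.
  have := hD.separable
  obtain ⟨A, hA, hAd⟩ := TopologicalSpace.exists_countable_dense (CoreSpace D)
  filter_upwards [(ae_ball_iff hA).2 fun f _ => hone f] with s hs
  exact DFunLike.coe_injective (Continuous.ext_on hAd (u s.toNNReal).continuous
    (v s.toNNReal).continuous hs)

namespace IsTiltedCurve

variable {T : FellerTransition E} {D : Submodule ℝ C(E, ℝ)} [TopologicalSpace (CoreSpace D)]
  {h : C(E, ℝ)} {t : ℝ≥0} {m : Measure E} [IsFiniteMeasure m] {ν : ℝ≥0 → ProbabilityMeasure E}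

/-- The Lagrangian along a tilted curve: the supremum is attained at `V(t - s) h`. -/
theorem lagrangian_eq (hν : IsTiltedCurve T h t m ν) (hD : IsTopologicalCore T D) (hh : h ∈ D)
    {s : ℝ≥0} (hs : s ≤ t) :
    lagrangian T (ν s) (hD.driftFunctional hh t m s)
      = ((integralCLM m (T.S s (T.gen (T.logTilt h t s * T.tilt h t s)
        - (1 + T.logTilt h t s) * T.gen (T.tilt h t s))) : ℝ) : EReal) := by
  have hterm : ∀ f : CoreSpace D, hD.driftFunctional hh t m s f
      - ∫ x, T.hamiltonian (incl D f) x ∂(ν s : Measure E)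
      = integralCLM m (T.S s (T.drift h t (incl D f) s
          - T.hamiltonian (incl D f) * T.tilt h t s)) := by
    intro f
    rw [hν.integral_of_le hs, S_sub, map_sub]
    rfl
  have hgD := (hD.isCoreCurve_logTilt hh t).mem (s : ℝ)
  have hkD := (hD.isCoreCurve_tilt hh t).mem (s : ℝ)
  refine le_antisymm (iSup_le fun f => ?_) ?_
  · rw [hterm f, EReal.coe_le_coe_iff]
    have hf := IsTopologicalCore.incl_mem f
    refine integralCLM_mono m (T.S_mono s fun x => ?_)
    have hdom := hD.subset_domain
    have := gen_mul_sub_le (T := T) (f := incl D f) (g := T.logTilt h t s)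
      (hdom _ (hD.expC_mem hf)) (hdom _ (hD.expC_mem hgD))
      (hdom _ (hD.mul_mem _ hf _ (hD.expC_mem hgD)))
      (hdom _ (hD.mul_mem _ hgD _ (hD.expC_mem hgD))) x
    rwa [expC_logTilt] at this
  · refine le_iSup_of_le (show CoreSpace D from (⟨_, hgD⟩ : D)) ?_
    rw [hterm, EReal.coe_le_coe_iff]
    refine le_of_eq ?_
    change _ = integralCLM m (T.S s (T.drift h t (T.logTilt h t s) s
          - T.hamiltonian (T.logTilt h t s) * T.tilt h t s))
    rw [drift, ← expC_logTilt T h t s, hamiltonian_mul_expC]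
    congr 2
    ring

theorem lagrangian_nonneg (T : FellerTransition E) (μ : ProbabilityMeasure E)
    (u : CoreSpace D →L[ℝ] ℝ) : 0 ≤ lagrangian T μ u := by
  refine le_iSup_of_le 0 ?_
  simp [hamiltonian_zero]

/-- Along the curve the Lagrangian is almost everywhere the right derivative of `s ↦ ⟨V(t-s)h,
ν(s)⟩`, so the fundamental theorem of calculus leaves only the endpoints. -/
theorem lagrangianCost_eq (hν : IsTiltedCurve T h t m ν) (hD : IsTopologicalCore T D) (hh : h ∈ D)
    {u : ℝ≥0 → CoreSpace D →L[ℝ] ℝ} (hu : IsDerivativeOf u ν) :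
    lagrangianCost T ν u t = ENNReal.ofReal
      (∫ x, h x ∂(ν t : Measure E) - ∫ x, T.V t h x ∂(ν 0 : Measure E)) := by
  set ℓ : ℝ → ℝ := fun s => integralCLM m (T.S s.toNNReal (T.gen (T.logTilt h t s * T.tilt h t s)
        - (1 + T.logTilt h t s) * T.gen (T.tilt h t s))) with hℓ
  have hgc := hD.isCoreCurve_logTilt hh t
  have hkc := hD.isCoreCurve_tilt hh t
  have hgkc := hD.isCoreCurve_mul hgc hkc
  have hℓc : Continuous ℓ := (integralCLM m).continuous.comp
    (T.continuous_S_comp continuous_real_toNNReal ((hD.continuous_gen_curve hgkc).sub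
      ((continuous_const.add (hD.continuous_curve hgc)).mul (hD.continuous_gen_curve hkc))))
  have hae : ∀ᵐ s : ℝ ∂volume.restrict (Set.Icc 0 (t : ℝ)),
      lagrangian T (ν s.toNNReal) (u s.toNNReal) = (ℓ s : EReal) := by
    -- At `s = t` the velocity has already switched to its untilted form.
    have hne : ∀ᵐ s : ℝ ∂volume.restrict (Set.Icc 0 (t : ℝ)), s ≠ t :=
      ae_restrict_of_ae (by simp [ae_iff, measure_singleton])
    filter_upwards [hu.ae_eq hD (hν.isDerivativeOf_velocity hD hh) t, hne,
      ae_restrict_mem measurableSet_Icc] with s hs hst hmem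
    have hlt : s.toNNReal < t :=
      (Real.toNNReal_lt_iff_lt_coe hmem.1).2 (lt_of_le_of_ne hmem.2 hst)
    rw [hs, velocity, if_pos hlt, hν.lagrangian_eq hD hh hlt.le, Real.coe_toNNReal _ hmem.1]
  have hnn : 0 ≤ᵐ[volume.restrict (Set.Icc 0 (t : ℝ))] ℓ := by
    filter_upwards [hae] with s hs
    have := lagrangian_nonneg T (ν s.toNNReal) (u s.toNNReal)
    rw [hs] at this
    exact_mod_cast this
  have h1 : lagrangianCost T ν u t = ∫⁻ s in Set.Icc (0 : ℝ) t, ENNReal.ofReal (ℓ s) := by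
    refine lintegral_congr_ae ?_
    filter_upwards [hae] with s hs
    rw [hs, EReal.real_coe_toENNReal]
  rw [h1, ← ofReal_integral_eq_lintegral_ofReal hℓc.integrableOn_Icc hnn,
    integral_Icc_eq_integral_Ioc, ← intervalIntegral.integral_of_le t.coe_nonneg]
  have hc : Continuous fun r : ℝ =>
      integralCLM m (T.S r.toNNReal (T.logTilt h t r * T.tilt h t r)) :=
    (integralCLM m).continuous.comp (T.continuous_S_comp continuous_real_toNNReal
      (hD.continuous_curve hgkc))
  rw [intervalIntegral.integral_eq_sub_of_hasDeriv_right_of_le t.coe_nonneg hc.continuousOn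
    (fun s hs => (integralCLM m).hasFDerivAt.comp_hasDerivWithinAt s
      (hD.hasDerivWithinAt_S_mul_logTilt hh hs.1.le hs.2)) (hℓc.intervalIntegrable _ _)]
  have e0 : T.logTilt h t t = h := by simp [logTilt, V_zero_apply]
  have e1 : T.logTilt h t (0 : ℝ) = T.V t h := by simp [logTilt]
  congr 2
  · rw [hν.integral_of_le le_rfl, e0, Real.toNNReal_coe]
  · rw [hν.integral_of_le (zero_le : (0 : ℝ≥0) ≤ t), e1, Real.toNNReal_zero, NNReal.coe_zero]

end IsTiltedCurve

end DoobEntropy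

end

/-! ### Relative entropies on path space. -/

noncomputable section

namespace DoobEntropy

open FellerTransition CadlagPath InformationTheory

/-- The logarithm need only be known `Q`-almost everywhere, which avoids the zeros of `d`.
Nonnegativity is recorded so that `ENNReal.ofReal` can later be split over sums. -/
theorem klDiv_withDensity {α : Type*} [MeasurableSpace α] {P Q : Measure α}
    [IsProbabilityMeasure P] [IsProbabilityMeasure Q] {d : α → ℝ≥0} (hd : Measurable d)
    (hQ : Q = P.withDensity fun x => (d x : ℝ≥0∞)) {l : α → ℝ}
    (hl : ∀ᵐ x ∂Q, Real.log (d x) = l x) :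
    (Integrable l Q → klDiv Q P = ENNReal.ofReal (∫ x, l x ∂Q) ∧ 0 ≤ ∫ x, l x ∂Q) ∧
      (¬ Integrable l Q → klDiv Q P = ∞) := by
  have hac : Q ≪ P := hQ ▸ withDensity_absolutelyContinuous _ _
  have hllr : llr Q P =ᵐ[Q] l := by
    have h1 : Q.rnDeriv P =ᵐ[P] fun x => (d x : ℝ≥0∞) := by
      rw [hQ]
      exact P.rnDeriv_withDensity hd.coe_nnreal_ennreal
    filter_upwards [hac.ae_eq h1, hl] with x hx hlx
    rw [llr, hx, ENNReal.coe_toReal, hlx]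
  refine ⟨fun hi => ?_, fun hi => klDiv_of_not_integrable fun h => hi ((integrable_congr hllr).1 h)⟩
  have hi' : Integrable (llr Q P) Q := (integrable_congr hllr).2 hi
  have h1 := klDiv_of_ac_of_integrable hac hi'
  have h2 := integral_llr_add_sub_measure_univ_nonneg hac hi'
  rw [integral_congr_ae hllr] at h1 h2
  -- `klDiv` carries a correction by total masses, which cancels for probability measures.
  simp only [probReal_univ, add_sub_cancel_right] at h1 h2
  exact ⟨h1, h2⟩

variable {E : Type*} [MetricSpace E] [CompactSpace E] [MeasurableSpace E] [BorelSpace E]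

variable {T : FellerTransition E} {P₀ : Measure E} {P : Measure (CadlagPath E)} {t : ℝ≥0}
  {h : C(E, ℝ)} {ρ₀ : E → ℝ≥0} {Q : Measure (CadlagPath E)}

/-- The density of the initial law of the tilted path measure. -/
def initialDensity (T : FellerTransition E) (h : C(E, ℝ)) (t : ℝ≥0) (ρ₀ : E → ℝ≥0) (x : E) : ℝ≥0 :=
  ρ₀ x * (T.S t (expC h) x).toNNReal

theorem measurable_initialDensity (hρ₀ : Measurable ρ₀) :
    Measurable (initialDensity T h t ρ₀) :=
  hρ₀.mul (T.S t (expC h)).continuous.measurable.real_toNNReal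

theorem coe_initialDensity (x : E) :
    (initialDensity T h t ρ₀ x : ℝ) = ρ₀ x * T.S t (expC h) x := by
  rw [initialDensity, NNReal.coe_mul, Real.coe_toNNReal _ (T.S_expC_pos t h x).le]

theorem exp_V (x : E) : Real.exp (T.V t h x) = T.S t (expC h) x :=
  Real.exp_log (T.S_expC_pos t h x)

/-- The density of the tilted path measure. -/
def pathDensity (h : C(E, ℝ)) (t : ℝ≥0) (ρ₀ : E → ℝ≥0) (X : CadlagPath E) : ℝ≥0 :=
  ρ₀ (X.eval 0) * (expC h (X.eval t)).toNNReal

theorem measurable_pathDensity (hρ₀ : Measurable ρ₀) : Measurable (pathDensity h t ρ₀) :=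
  (hρ₀.comp (measurable_eval 0)).mul (measurable_continuousMap_eval (expC h) t).real_toNNReal

theorem coe_pathDensity (X : CadlagPath E) :
    (pathDensity h t ρ₀ X : ℝ) = ρ₀ (X.eval 0) * expC h (X.eval t) := by
  rw [pathDensity, NNReal.coe_mul, expC_apply, Real.coe_toNNReal _ (Real.exp_pos _).le]

/-- The path density is integrable, and multiplying it by the bounded function `e^{-h(X t)}` leaves
`ρ₀(X 0)`. -/
theorem integrable_of_isProbabilityMeasure_withDensity (hP : T.IsMarkovMeasure P₀ P)
    (hρ₀ : Measurable ρ₀) [IsProbabilityMeasure Q]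
    (hQ : Q = P.withDensity fun X => (pathDensity h t ρ₀ X : ℝ≥0∞)) :
    Integrable (fun x => (ρ₀ x : ℝ)) P₀ := by
  rw [hP.integrable_initial_iff (ρ := fun x => (ρ₀ x : ℝ)) (measurable_coe_nnreal_real.comp hρ₀)]
  have h1 : Integrable (fun X => (pathDensity h t ρ₀ X : ℝ)) P := by
    have hc : Integrable (fun _ => (1 : ℝ)) Q := integrable_const _
    rw [hQ, integrable_withDensity_iff_integrable_smul (measurable_pathDensity hρ₀)] at hc
    simpa [NNReal.smul_def] using hc
  refine (integrable_mul_eval h1 (expC (-h)) t).congr (Eventually.of_forall fun X => ?_)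
  simp only [coe_pathDensity, expC_apply, ContinuousMap.neg_apply, mul_assoc, ← Real.exp_add,
    add_neg_cancel, Real.exp_zero, mul_one]

theorem isFiniteMeasure_withDensity_coe {α : Type*} [MeasurableSpace α] {μ : Measure α}
    {ρ : α → ℝ≥0} (hρ : Integrable (fun x => (ρ x : ℝ)) μ) :
    IsFiniteMeasure (μ.withDensity fun x => (ρ x : ℝ≥0∞)) :=
  isFiniteMeasure_withDensity (hasFiniteIntegral_iff_ofNNReal.1 hρ.2).ne

theorem isTiltedCurve_law (hP : T.IsMarkovMeasure P₀ P) (hρ₀ : Measurable ρ₀)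
    (hρi : Integrable (fun x => (ρ₀ x : ℝ)) P₀) [IsProbabilityMeasure Q]
    (hQ : Q = P.withDensity fun X => (pathDensity h t ρ₀ X : ℝ≥0∞))
    [IsFiniteMeasure (P₀.withDensity fun x => (ρ₀ x : ℝ≥0∞))] :
    IsTiltedCurve T h t (P₀.withDensity fun x => (ρ₀ x : ℝ≥0∞)) (law Q) := by
  intro s F
  have hρm : Measurable fun x => (ρ₀ x : ℝ) := measurable_coe_nnreal_real.comp hρ₀
  rw [integralCLM_apply, integral_withDensity_eq_integral_smul hρ₀]
  have h1 : ∫ x, F x ∂(law Q s : Measure E) = ∫ X, F (X.eval s) ∂Q :=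
    integral_map (measurable_eval s).aemeasurable F.continuous.aestronglyMeasurable
  rw [h1, hQ, integral_withDensity_eq_integral_smul (measurable_pathDensity hρ₀)]
  simp only [NNReal.smul_def, smul_eq_mul, coe_pathDensity]
  rcases le_total s t with hst | hst
  · have := hP.integral_two hρm hρi hst F (expC h)
    rw [min_eq_left hst, tsub_eq_zero_of_le hst, S_zero_apply, mul_comm (T.S _ _), ← this]
    congr 1
    ext X
    ring
  · rw [min_eq_right hst, tsub_eq_zero_of_le hst, S_zero_apply]
    exact hP.integral_two hρm hρi hst (expC h) F

theorem law_zero_eq (hρ₀ : Measurable ρ₀) (hρi : Integrable (fun x => (ρ₀ x : ℝ)) P₀)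
    [IsProbabilityMeasure Q] [IsFiniteMeasure (P₀.withDensity fun x => (ρ₀ x : ℝ≥0∞))]
    (hν : IsTiltedCurve T h t (P₀.withDensity fun x => (ρ₀ x : ℝ≥0∞)) (law Q)) :
    (law Q 0 : Measure E) = P₀.withDensity fun x => (initialDensity T h t ρ₀ x : ℝ≥0∞) := by
  have hm : Measurable (initialDensity T h t ρ₀) := measurable_initialDensity hρ₀
  have hi : Integrable (fun x => (initialDensity T h t ρ₀ x : ℝ)) P₀ := by
    simp only [coe_initialDensity]
    exact hρi.mul_bdd (c := ‖T.S t (expC h)‖) (ContinuousMap.continuous _).aestronglyMeasurable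
      (Eventually.of_forall fun x => ContinuousMap.norm_coe_le_norm _ x)
  have := isFiniteMeasure_withDensity_coe hi
  refine ext_of_forall_integral_eq_of_IsFiniteMeasure fun f => ?_
  have h1 := hν 0 f.toContinuousMap
  rw [min_eq_left (zero_le : 0 ≤ t), tsub_eq_zero_of_le (zero_le : 0 ≤ t), S_zero_apply,
    S_zero_apply, tsub_zero, integralCLM_apply, integral_withDensity_eq_integral_smul hρ₀] at h1
  rw [integral_withDensity_eq_integral_smul hm]
  refine h1.trans (integral_congr_ae (Eventually.of_forall fun x => ?_))
  simp only [NNReal.smul_def, smul_eq_mul, coe_initialDensity, ContinuousMap.mul_apply, mul_assoc]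
  rfl

/-- The path measure started from the tilted initial law. -/
theorem isMarkovMeasure_tilted (hP : T.IsMarkovMeasure P₀ P) (hρ₀ : Measurable ρ₀)
    [IsProbabilityMeasure Q]
    (hQ₀ : (law Q 0 : Measure E) = P₀.withDensity fun x => (initialDensity T h t ρ₀ x : ℝ≥0∞)) :
    T.IsMarkovMeasure (law Q 0 : Measure E)
      (P.withDensity fun X => (initialDensity T h t ρ₀ (X.eval 0) : ℝ≥0∞)) := by
  have h1 : ∫⁻ x, initialDensity T h t ρ₀ x ∂P₀ = 1 := by
    rw [← setLIntegral_univ, ← withDensity_apply _ .univ, ← hQ₀, measure_univ]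
  rw [hQ₀]
  exact hP.withDensity (measurable_initialDensity hρ₀) h1

/-- The density of the tilted path measure with respect to the Markov measure with the same
initial law. -/
theorem eq_withDensity_tilted (hρ₀ : Measurable ρ₀)
    (hQ : Q = P.withDensity fun X => (pathDensity h t ρ₀ X : ℝ≥0∞)) :
    Q = (P.withDensity fun X => (initialDensity T h t ρ₀ (X.eval 0) : ℝ≥0∞)).withDensity
      fun X => ((Real.exp (h (X.eval t) - T.V t h (X.eval 0))).toNNReal : ℝ≥0∞) := by
  rw [← withDensity_mul, hQ]
  · congr 1
    ext X
    rw [Pi.mul_apply, ← ENNReal.coe_mul, ENNReal.coe_inj, ← NNReal.coe_inj, coe_pathDensity,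
      NNReal.coe_mul, coe_initialDensity, Real.coe_toNNReal _ (Real.exp_pos _).le, Real.exp_sub,
      exp_V, expC_apply]
    have := (T.S_expC_pos t h (X.eval 0)).ne'
    field_simp
  · exact ((measurable_initialDensity hρ₀).comp (measurable_eval 0)).coe_nnreal_ennreal
  · exact ((measurable_continuousMap_eval h t).sub
      (measurable_continuousMap_eval (T.V t h) 0)).exp.real_toNNReal.coe_nnreal_ennreal

theorem klDiv_tilted [IsProbabilityMeasure Q] {P' : Measure (CadlagPath E)}
    [IsProbabilityMeasure P'] (hQ : Q = P'.withDensity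
      fun X => ((Real.exp (h (X.eval t) - T.V t h (X.eval 0))).toNNReal : ℝ≥0∞)) :
    klDiv Q P' = ENNReal.ofReal (∫ X, (h (X.eval t) - T.V t h (X.eval 0)) ∂Q) ∧
      0 ≤ ∫ X, (h (X.eval t) - T.V t h (X.eval 0)) ∂Q := by
  refine (klDiv_withDensity ?_ hQ (Eventually.of_forall fun X => ?_)).1 ?_
  · exact ((measurable_continuousMap_eval h t).sub
      (measurable_continuousMap_eval (T.V t h) 0)).exp.real_toNNReal
  · rw [Real.coe_toNNReal _ (Real.exp_pos _).le, Real.log_exp]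
  · exact (integrable_eval h t).sub (integrable_eval (T.V t h) 0)

/-- The two log-densities differ by a bounded function, so they are integrable together: the
identity is either a sum of finite integrals or `∞ = ∞`. -/
theorem klDiv_eq_add (hP : T.IsMarkovMeasure P₀ P) (hρ₀ : Measurable ρ₀) [IsProbabilityMeasure Q]
    (hQ : Q = P.withDensity fun X => (pathDensity h t ρ₀ X : ℝ≥0∞))
    (hQ₀ : (law Q 0 : Measure E) = P₀.withDensity fun x => (initialDensity T h t ρ₀ x : ℝ≥0∞))
    (hnn : 0 ≤ ∫ X, (h (X.eval t) - T.V t h (X.eval 0)) ∂Q) :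
    klDiv Q P = klDiv (law Q 0 : Measure E) P₀
      + ENNReal.ofReal (∫ X, (h (X.eval t) - T.V t h (X.eval 0)) ∂Q) := by
  have := hP.isProb
  have : IsProbabilityMeasure P₀ := by
    rw [← hP.initial]
    exact Measure.isProbabilityMeasure_map (measurable_eval 0).aemeasurable
  have hm : Measurable (initialDensity T h t ρ₀) := measurable_initialDensity hρ₀
  set l : E → ℝ := fun x => Real.log (initialDensity T h t ρ₀ x) with hl
  have hlm : Measurable l := Real.measurable_log.comp (measurable_coe_nnreal_real.comp hm)
  have h₀ := klDiv_withDensity hm hQ₀ (l := l) (Eventually.of_forall fun _ => rfl)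
  -- Since `Real.log 0 = 0`, the logarithm of the product splits only off the zeros of `ρ₀`, which
  -- `Q` does not charge.
  have hne : ∀ᵐ X ∂Q, ρ₀ (X.eval 0) ≠ 0 := by
    rw [hQ, ae_withDensity_iff (measurable_pathDensity hρ₀).coe_nnreal_ennreal]
    refine Eventually.of_forall fun X hX h0 => hX ?_
    simp [pathDensity, h0]
  have h₁ := klDiv_withDensity (measurable_pathDensity hρ₀) hQ
    (l := fun X => l (X.eval 0) + (h (X.eval t) - T.V t h (X.eval 0))) (by
      filter_upwards [hne] with X hX
      have hX' : (ρ₀ (X.eval 0) : ℝ) ≠ 0 := NNReal.coe_ne_zero.2 hX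
      rw [hl, coe_pathDensity]
      simp only [coe_initialDensity]
      rw [← exp_V, expC_apply, Real.log_mul hX' (Real.exp_pos _).ne',
        Real.log_mul hX' (Real.exp_pos _).ne', Real.log_exp, Real.log_exp]
      ring)
  have hbi : Integrable (fun X : CadlagPath E => h (X.eval t) - T.V t h (X.eval 0)) Q :=
    (integrable_eval h t).sub (integrable_eval (T.V t h) 0)
  have hmap : Integrable l (law Q 0 : Measure E) ↔ Integrable (fun X => l (X.eval 0)) Q :=
    integrable_map_measure hlm.aestronglyMeasurable (measurable_eval 0).aemeasurable
  have hint : ∫ x, l x ∂(law Q 0 : Measure E) = ∫ X, l (X.eval 0) ∂Q :=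
    integral_map (measurable_eval 0).aemeasurable hlm.aestronglyMeasurable
  by_cases hi : Integrable l (law Q 0 : Measure E)
  · have hi' := hmap.1 hi
    obtain ⟨e0, hnn0⟩ := h₀.1 hi
    rw [(h₁.1 (hi'.add hbi)).1, e0, ← ENNReal.ofReal_add hnn0 hnn, hint]
    congr 1
    exact integral_add hi' hbi
  · rw [h₀.2 hi, top_add]
    refine h₁.2 fun hs => hi (hmap.2 ?_)
    refine (hs.sub hbi).congr (Eventually.of_forall fun X => ?_)
    simp

end DoobEntropy

end

theorem mainTheorem9 {E : Type*} [MetricSpace E] [CompactSpace E] [MeasurableSpace E]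
    [BorelSpace E] (T : DoobEntropy.FellerTransition E)
    (D : Submodule ℝ C(E, ℝ)) [TopologicalSpace (DoobEntropy.CoreSpace D)]
    (hD : DoobEntropy.IsTopologicalCore T D)
    (P₀ : Measure E) (P : Measure (DoobEntropy.CadlagPath E)) (hP : T.IsMarkovMeasure P₀ P)
    (t : ℝ≥0) (h : C(E, ℝ)) (hh : h ∈ D) (ρ₀ : E → ℝ≥0) (hρ₀ : Measurable ρ₀)
    (Q : Measure (DoobEntropy.CadlagPath E)) [IsProbabilityMeasure Q]
    (hQ : Q = P.withDensity fun X =>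
      (ρ₀ (X.eval 0) : ℝ≥0∞) * ENNReal.ofReal (Real.exp (h (X.eval t)))) :
    (∃ P' : Measure (DoobEntropy.CadlagPath E),
      T.IsMarkovMeasure (DoobEntropy.CadlagPath.law Q 0 : Measure E) P') ∧
    (∀ P' : Measure (DoobEntropy.CadlagPath E),
      T.IsMarkovMeasure (DoobEntropy.CadlagPath.law Q 0 : Measure E) P' →
        InformationTheory.klDiv Q P
          = InformationTheory.klDiv (DoobEntropy.CadlagPath.law Q 0 : Measure E) P₀
            + InformationTheory.klDiv Q P') ∧
    DoobEntropy.IsAbsolutelyContinuousCurve D (DoobEntropy.CadlagPath.law Q) ∧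
    (∀ γ' : ℝ≥0 → DoobEntropy.CoreSpace D →L[ℝ] ℝ,
      DoobEntropy.IsDerivativeOf γ' (DoobEntropy.CadlagPath.law Q) →
        InformationTheory.klDiv Q P
          = InformationTheory.klDiv (DoobEntropy.CadlagPath.law Q 0 : Measure E) P₀
            + DoobEntropy.lagrangianCost T (DoobEntropy.CadlagPath.law Q) γ' t) := by
  have hQ' : Q = P.withDensity fun X => (DoobEntropy.pathDensity h t ρ₀ X : ℝ≥0∞) := by
    rw [hQ]
    congr 1
  have hρi := DoobEntropy.integrable_of_isProbabilityMeasure_withDensity hP hρ₀ hQ'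
  have := DoobEntropy.isFiniteMeasure_withDensity_coe hρi
  have hν := DoobEntropy.isTiltedCurve_law hP hρ₀ hρi hQ'
  have hQ₀ := DoobEntropy.law_zero_eq hρ₀ hρi hν
  have hM := DoobEntropy.isMarkovMeasure_tilted hP hρ₀ hQ₀
  have hMprob := hM.isProb
  have hkl := DoobEntropy.klDiv_tilted (DoobEntropy.eq_withDensity_tilted (T := T) hρ₀ hQ')
  have hadd := DoobEntropy.klDiv_eq_add hP hρ₀ hQ' hQ₀ hkl.2
  refine ⟨⟨_, hM⟩, fun P' hP' => ?_, ⟨hν.continuous, _, hν.isDerivativeOf_velocity hD hh⟩,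
    fun γ' hγ' => ?_⟩
  -- Uniqueness identifies any admissible `P'` with the reweighted measure, whose density against
  -- `Q` is explicit.
  · rw [hadd, hP'.unique hM, hkl.1]
  · rw [hadd, hν.lagrangianCost_eq hD hh hγ', integral_sub
      (DoobEntropy.FellerTransition.integrable_eval h t)
      (DoobEntropy.FellerTransition.integrable_eval (T.V t h) 0)]
    congr 3
    · exact (integral_map (DoobEntropy.CadlagPath.measurable_eval t).aemeasurable
        h.continuous.aestronglyMeasurable).symm
    · exact (integral_map (DoobEntropy.CadlagPath.measurable_eval 0).aemeasurable
        (T.V t h).continuous.aestronglyMeasurable).symm
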